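/- **Setting.** There are $M\ge 1$ clients with differentiable objectives $\mathcal L_i:\mathbb R^d\to\mathbb R$ and importances $p_i\ge 0$, $\sum_i p_i=1$; the global objective is $\mathcal L=\sum_i p_i\mathcal L_i$, assumed bounded below. *FedAvg* with $K\ge1$ local steps, local step size $\eta_l>0$ and server step size $\eta_g>0$ starts at a deterministic $\theta^0$. In round $t$ client $i$ sets $\theta_i^{t,0}=\theta^t$, $\theta_i^{t,k+1}=\theta_i^{t,k}-\eta_l\, g_i(\theta_i^{t,k},\xi_i^{t,k})$ for $0\le k<K$, and $$\theta^{t+1}=\theta^t+\eta_g\sum_{i=1}^M\omega_i(S_t)\,(\theta_i^{t,K}-\theta^t).$$ *Clustered sampling* of $m\ge1$ clients is given by numbers $r_{k,i}\ge0$ ($1\le k\le m$, $1\le i\le M$) with $\sum_i r_{k,i}=1$ and $\sum_k r_{k,i}=m p_i$: independently for each $k$, a client $\ell_k$ is drawn with $\mathbb P(\ell_k=i)=r_{k,i}$, and $\omega_i(S)=\frac1m\#\{k:\ell_k=i\}$. *MD sampling* is the case $r_{k,i}=p_i$. We write $S_{Cl}$ and $S_{MD}$ for the two kinds of sample. The samples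 $S_t$ (each with the law of $S_{Cl}$) and all batches $\xi_i^{t,k}$ are mutually independent. **Assumptions.** (1) $\|\nabla\mathcal L_i(x)-\nabla\mathcal L_i(y)\|\le L\|x-y\|$ for all $i,x,y$. (2) $g_i(x,\xi_i^{t,k})$ is square integrable with $\mathbb E[g_i(x,\xi_i^{t,k})]=\nabla\mathcal L_i(x)$ and $\mathbb E\|g_i(x,\xi_i^{t,k})-\nabla\mathcal L_i(x)\|^2\le\sigma^2$. (3) $\sum_i p_i\|\nabla\mathcal L_i(x)\|^2\le\beta^2\|\sum_i p_i\nabla\mathcal L_i(x)\|^2+\kappa^2$ for all $x$, with $\beta\ge1$. No relation of the form $\mathrm{Cov}(\omega_i(S),\omega_j(S))=-\alpha p_ip_j$ $(i\ne j)$ is assumed of the sampling. **Claim.** (a) There are clustered sampling schemes for which no $\alpha$ satisfies $\mathrm{Cov}(\omega_i(S_{Cl}),\omega_j(S_{Cl}))=-\alpha p_ip_j$ for all $i\neq j$. (b) For every clustered sampling scheme, $\mathrm{Var}[\omega_i(S_{Cl})]\le \mathrm{Var}[\omega_i(S_{MD})]$ for all $i$, and $$A:=m\sum_{i}\big(\mathrm{Var}[\omega_i(S_{Cl})]+p_i^2\big)=m\Big[\frac1m-\frac1{m^2}\sum_{i=1}^M\sum_{k=1}^m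 r_{k,i}^2+\sum_{i=1}^M p_i^2\Big],$$ which is at most the corresponding quantity $m\sum_i(\mathrm{Var}[\omega_i(S_{MD})]+p_i^2)$ of MD sampling. MD sampling satisfies $\mathrm{Cov}(\omega_i(S_{MD}),\omega_j(S_{MD}))=-\alpha_{MD}\,p_ip_j$ for $i\ne j$, with $\alpha_{MD}=\frac1m$, and $$E:=(K-1)\Big(\sum_i\mathrm{Var}[\omega_i(S_{MD})]+\alpha_{MD}\sum_ip_i^2\Big)=\frac{K-1}{m},\qquad F:=K\Big(\sum_i\mathrm{Var}[\omega_i(S_{MD})]+\alpha_{MD}\sum_ip_i^2\Big)=\frac Km .$$ (c) There are absolute constants $c,C_0>0$ such that, for FedAvg with clustered sampling under the assumptions above, whenever $\eta_l$ is so small that $\eta_l(1+\eta_g)\beta^2LK\le c$, then $\mathbb E\|\nabla\mathcal L(\theta^t)\|^2<\infty$ for all $t$ and, for all $T\ge1$, with $\tilde\eta=\eta_g\eta_l$, $B=K-1$ and $C=K(K-1)$, $$\frac1T\sum_{t=0}^{T-1}\mathbb E\|\nabla\mathcal L(\theta^t)\|^2\le C_0\Big(\frac{\mathcal L(\theta^0)-\inf\mathcal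 L}{\tilde\eta KT}+L\tilde\eta\,\frac{A}{m}\,\sigma^2+L^2\eta_l^2B\sigma^2+L^2\eta_l^2C\kappa^2+L\tilde\eta\,(E\sigma^2+F\kappa^2)\Big).$$ -/

import Mathlib

open MeasureTheory ProbabilityTheory

noncomputable section

namespace FedSampling

/-- The model space `ℝ^d` with its Euclidean norm. -/
abbrev Model (d : ℕ) := EuclideanSpace ℝ (Fin d)

/-! ### Client sampling -/

/-- The distribution on the clients `0, …, M-1` that gives client `i` the probability `q i`. -/
def categorical {M : ℕ} (q : Fin M → ℝ) : Measure (Fin M) :=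
  ∑ i, ENNReal.ofReal (q i) • Measure.dirac i

/-- `p` is a vector of client importances: nonnegative, with sum one. -/
def IsImportance {M : ℕ} (p : Fin M → ℝ) : Prop :=
  (∀ i, 0 ≤ p i) ∧ ∑ i, p i = 1

/-- The `m` selection distributions `r 0, …, r (m-1)` of a clustered sampling scheme for the
importances `p`: each `r k` is a probability vector, and `∑ₖ r k i = m p i` for every client. -/
structure IsClusteredSampling {M m : ℕ} (p : Fin M → ℝ) (r : Fin m → Fin M → ℝ) : Prop where
  nonneg : ∀ k i, 0 ≤ r k i
  sum_clients : ∀ k, ∑ i, r k i = 1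
  sum_clusters : ∀ i, ∑ k, r k i = m * p i

/-- Law of the `m` clients drawn by clustered sampling: the `k`-th client is drawn from `r k`,
independently of the other draws. -/
def clusteredLaw {M m : ℕ} (r : Fin m → Fin M → ℝ) : Measure (Fin m → Fin M) :=
  Measure.pi fun k => categorical (r k)

/-- Law of the `m` clients drawn by MD sampling: `m` i.i.d. draws from the distribution `p`. -/
def mdLaw {M : ℕ} (m : ℕ) (p : Fin M → ℝ) : Measure (Fin m → Fin M) :=
  Measure.pi fun _ => categorical p

/-- The aggregation weight `ω_i(s)`: client `i` gets `1/m` for each time it was drawn in `s`. -/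
def aggWeight {M m : ℕ} (s : Fin m → Fin M) (i : Fin M) : ℝ :=
  (1 / (m : ℝ)) * ∑ k, if s k = i then 1 else 0

/-- The variance of `ω_i(s)` when `s` has law `μ`. -/
def weightVar {M m : ℕ} (μ : Measure (Fin m → Fin M)) (i : Fin M) : ℝ :=
  variance (fun s => aggWeight s i) μ

/-- The covariance structure `Cov(ω_i, ω_j) = -α p_i p_j` for all `i ≠ j`. -/
def HasCovStructure {M m : ℕ} (μ : Measure (Fin m → Fin M)) (p : Fin M → ℝ) (α : ℝ) : Prop :=
  ∀ i j, i ≠ j →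
    covariance (fun s => aggWeight s i) (fun s => aggWeight s j) μ = -α * p i * p j

/-! ### The quantities in the convergence bound of FedAvg with `K` local steps -/

/-- `A = m ∑ᵢ (Var ω_i + p_i²)`. -/
def termA {M m : ℕ} (μ : Measure (Fin m → Fin M)) (p : Fin M → ℝ) : ℝ :=
  m * ∑ i, (weightVar μ i + p i ^ 2)

/-- `B = K - 1`. -/
def termB (K : ℕ) : ℝ := (K : ℝ) - 1

/-- `C = K (K - 1)`. -/
def termC (K : ℕ) : ℝ := (K : ℝ) * ((K : ℝ) - 1)

/-- `E = (K - 1) (∑ᵢ Var ω_i + α ∑ᵢ p_i²)`. -/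
def termE {M m : ℕ} (K : ℕ) (μ : Measure (Fin m → Fin M)) (p : Fin M → ℝ) (α : ℝ) : ℝ :=
  ((K : ℝ) - 1) * (∑ i, weightVar μ i + α * ∑ i, p i ^ 2)

/-- `F = K (∑ᵢ Var ω_i + α ∑ᵢ p_i²)`. -/
def termF {M m : ℕ} (K : ℕ) (μ : Measure (Fin m → Fin M)) (p : Fin M → ℝ) (α : ℝ) : ℝ :=
  (K : ℝ) * (∑ i, weightVar μ i + α * ∑ i, p i ^ 2)

/-! ### The federated problem -/

/-- The global objective `∑ᵢ p_i ℒ_i`. -/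
def globalLoss {d M : ℕ} (p : Fin M → ℝ) (loss : Fin M → Model d → ℝ) (x : Model d) : ℝ :=
  ∑ i, p i * loss i x

/-- Every local objective is differentiable with `L`-Lipschitz gradient. -/
def Smooth {d M : ℕ} (loss : Fin M → Model d → ℝ) (L : ℝ) : Prop :=
  ∀ i, Differentiable ℝ (loss i) ∧
    ∀ x y, ‖gradient (loss i) x - gradient (loss i) y‖ ≤ L * ‖x - y‖

/-- Bounded dissimilarity of the clients' gradients. -/
def BoundedDissimilarity {d M : ℕ} (p : Fin M → ℝ) (loss : Fin M → Model d → ℝ)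
    (β κ : ℝ) : Prop :=
  ∀ x, ∑ i, p i * ‖gradient (loss i) x‖ ^ 2 ≤
    β ^ 2 * ‖∑ i, p i • gradient (loss i) x‖ ^ 2 + κ ^ 2

/-- The stochastic gradients `g i x b` (client `i`, model `x`, batch `b`), evaluated on the random
batch `ξ t i k` that client `i` uses at local step `k` of round `t`, are unbiased estimates of
`∇ ℒ_i(x)` with variance at most `σ²`. -/
def UnbiasedBoundedVariance {d M : ℕ} {Ω Ξ : Type*} [MeasurableSpace Ω] (P : Measure Ω)
    (loss : Fin M → Model d → ℝ) (g : Fin M → Model d → Ξ → Model d)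
    (ξ : ℕ → Fin M → ℕ → Ω → Ξ) (σ : ℝ) : Prop :=
  ∀ t i k x, MemLp (fun w => g i x (ξ t i k w)) 2 P ∧
    ∫ w, g i x (ξ t i k w) ∂P = gradient (loss i) x ∧
    ∫ w, ‖g i x (ξ t i k w) - gradient (loss i) x‖ ^ 2 ∂P ≤ σ ^ 2

/-- The randomness of a run: in every round `t` the clients `S t` are drawn with law `μ`, and all
the draws `S t` and all the batches `ξ t i k` are mutually independent. -/
structure IsRunRandomness {M m : ℕ} {Ω Ξ : Type*} [MeasurableSpace Ω] [MeasurableSpace Ξ]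
    (P : Measure Ω) (μ : Measure (Fin m → Fin M))
    (S : ℕ → Ω → Fin m → Fin M) (ξ : ℕ → Fin M → ℕ → Ω → Ξ) : Prop where
  measurable_S : ∀ t, Measurable (S t)
  measurable_ξ : ∀ t i k, Measurable (ξ t i k)
  law_S : ∀ t, P.map (S t) = μ
  indep_S : iIndepFun S P
  indep_ξ : iIndepFun (fun q : ℕ × Fin M × ℕ => ξ q.1 q.2.1 q.2.2) P
  indep_S_ξ : IndepFun (fun w (t : ℕ) => S t w)
    (fun w (q : ℕ × Fin M × ℕ) => ξ q.1 q.2.1 q.2.2 w) P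

/-- The model after `k` local SGD steps with step size `ηl` from `θ` on the batches `b`. -/
def localSGD {d : ℕ} {Ξ : Type*} (g : Model d → Ξ → Model d) (ηl : ℝ) (θ : Model d)
    (b : ℕ → Ξ) : ℕ → Model d
  | 0 => θ
  | k + 1 => localSGD g ηl θ b k - ηl • g (localSGD g ηl θ b k) (b k)

/-- The global model of FedAvg after `t` rounds, for the drawn clients `s` and the batches `b`:
`θ^{t+1} = θ^t + η_g ∑ᵢ ω_i(s_t) (θ_i^{t+1} - θ^t)`, where `θ_i^{t+1}` is obtained from `θ^t` by
`K` local SGD steps of client `i`. -/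
def fedAvg {d M m : ℕ} {Ξ : Type*} (g : Fin M → Model d → Ξ → Model d) (ηg ηl : ℝ) (K : ℕ)
    (θ₀ : Model d) (s : ℕ → Fin m → Fin M) (b : ℕ → Fin M → ℕ → Ξ) : ℕ → Model d
  | 0 => θ₀
  | t + 1 => fedAvg g ηg ηl K θ₀ s b t + ηg • ∑ i, aggWeight (s t) i •
      (localSGD (g i) ηl (fedAvg g ηg ηl K θ₀ s b t) (b t i) K - fedAvg g ηg ηl K θ₀ s b t)

/-- The squared norm of the gradient of the global objective at the global model of round `t`,
as a random variable. -/
def gradSq {d M m : ℕ} {Ω Ξ : Type*} (p : Fin M → ℝ) (loss : Fin M → Model d → ℝ)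
    (g : Fin M → Model d → Ξ → Model d) (ηg ηl : ℝ) (K : ℕ) (θ₀ : Model d)
    (S : ℕ → Ω → Fin m → Fin M) (ξ : ℕ → Fin M → ℕ → Ω → Ξ) (t : ℕ) (w : Ω) : ℝ :=
  ‖gradient (globalLoss p loss)
    (fedAvg g ηg ηl K θ₀ (fun t => S t w) (fun t i k => ξ t i k w) t)‖ ^ 2

end FedSampling

end

/-! Everything about the sampling follows from the second moments of the weights, `E[ω_i ω_j] = p_i
p_j + m⁻² ∑ₖ (δ_ij r_ki - r_ki r_kj)`, which hold because the `m` draws are independent.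
Cauchy-Schwarz over the clusters gives the comparison with MD sampling, and a scheme in which one
client is drawn surely while two others compete for a single draw rules out a common `α`.

The convergence bound needs no covariance structure. For vectors `X_i` independent of the sample,
the moments above give `E‖∑ ω_i X_i‖² = E‖∑ p_i X_i‖² + m⁻¹ ∑ p_i E‖X_i‖² - m⁻² ∑ₖ E‖∑ r_ki X_i‖²`.
The last term is minus a sum of squares and is dropped (`integral_norm_aggregate_sq_le`). What
remains is a bound with the MD constant `1/m`, which is why the MD value of `F` appears for every
clustered scheme.

One round moves the model by `-η_g η_l (D + N)`, where `D` aggregates true gradients along the local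
paths and `N` aggregates gradient noise. The noise is centred, orthogonal across local steps and
independent across clients, so only the diagonal moments `Var ω_i + p_i²` enter and `E‖N‖² ≤ (A/m) K
σ²`. The drift `D` differs from `K` gradients at the starting model by an amount controlled by the
mean square displacement of the local models, which satisfies a self-bounding recursion for small
steps. Inserting this into the smoothness inequality yields `IsRound.expected_descent` for a
deterministic starting model, the constant `1/32` letting all gradient terms be absorbed.

The model `θ^t` is independent of the randomness of round `t`, so the one-round bound may be
integrated over `θ^t` and telescoped. This is done with extended nonnegative integrals of `ℒ - inf
ℒ`, so that integrability of the squared gradients is a conclusion. -/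

noncomputable section

namespace FedSampling

/-! ### Moments of the aggregation weights, and comparison with MD sampling. -/

theorem isProbabilityMeasure_categorical {M : ℕ} {q : Fin M → ℝ} (hq : ∀ i, 0 ≤ q i)
    (hs : ∑ i, q i = 1) : IsProbabilityMeasure (categorical q) := by
  constructor
  simp only [categorical, Measure.coe_finsetSum, Finset.sum_apply, Measure.smul_apply,
    measure_univ, smul_eq_mul, mul_one]
  rw [← ENNReal.ofReal_sum_of_nonneg (fun i _ => hq i), hs, ENNReal.ofReal_one]

theorem integral_categorical {M : ℕ} {q : Fin M → ℝ} (hq : ∀ i, 0 ≤ q i) (f : Fin M → ℝ) :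
    ∫ x, f x ∂(categorical q) = ∑ i, q i * f i := by
  unfold categorical
  rw [integral_finsetSum_measure]
  · refine Finset.sum_congr rfl fun i _ => ?_
    rw [integral_smul_measure, integral_dirac, ENNReal.toReal_ofReal (hq i), smul_eq_mul]
  · intro i _
    exact (integrable_dirac (by simp)).smul_measure ENNReal.ofReal_ne_top

/-- A function on a finite discrete space is in every `L^p` of a finite measure. -/
theorem memLp_of_finite {α : Type*} [Finite α] [MeasurableSpace α] [DiscreteMeasurableSpace α]
    {μ : Measure α} [IsFiniteMeasure μ] (f : α → ℝ) (q : ENNReal) : MemLp f q μ := by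
  cases nonempty_fintype α
  refine MemLp.of_bound (Measurable.of_discrete).aestronglyMeasurable (∑ x, ‖f x‖)
    (Filter.Eventually.of_forall fun x => ?_)
  exact Finset.single_le_sum (f := fun x => ‖f x‖) (fun _ _ => norm_nonneg _) (Finset.mem_univ x)

namespace IsClusteredSampling

variable {M m : ℕ} {p : Fin M → ℝ} {r : Fin m → Fin M → ℝ}

theorem isProbabilityMeasure_categorical (h : IsClusteredSampling p r) (k : Fin m) :
    IsProbabilityMeasure (categorical (r k)) :=
  FedSampling.isProbabilityMeasure_categorical (h.nonneg k) (h.sum_clients k)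

theorem isProbabilityMeasure_law (h : IsClusteredSampling p r) :
    IsProbabilityMeasure (clusteredLaw r) := by
  have := h.isProbabilityMeasure_categorical
  unfold clusteredLaw
  infer_instance

theorem integral_eval (h : IsClusteredSampling p r) (k : Fin m) (f : Fin M → ℝ) :
    ∫ s, f (s k) ∂(clusteredLaw r) = ∑ i, r k i * f i := by
  have := h.isProbabilityMeasure_categorical
  rw [← integral_categorical (h.nonneg k)]
  rw [← (measurePreserving_eval (fun k => categorical (r k)) k).map_eq, integral_map
    (measurable_pi_apply k).aemeasurable Measurable.of_discrete.aestronglyMeasurable]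
  rfl

theorem covariance_eval (h : IsClusteredSampling p r) (k l : Fin m) (i j : Fin M) :
    covariance (fun s => if s k = i then (1 : ℝ) else 0) (fun s => if s l = j then (1 : ℝ) else 0)
      (clusteredLaw r) = if k = l then (if i = j then r k i else 0) - r k i * r k j else 0 := by
  have := h.isProbabilityMeasure_categorical
  have := h.isProbabilityMeasure_law
  split_ifs with hkl hij
  · subst hkl hij
    rw [covariance_eq_sub (memLp_of_finite _ _) (memLp_of_finite _ _)]
    have h1 := h.integral_eval k (fun x => (if x = i then (1 : ℝ) else 0))
    simp only [mul_ite, mul_one, mul_zero, Finset.sum_ite_eq', Finset.mem_univ, if_true] at h1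
    have h2 : (fun s : Fin m → Fin M => if s k = i then (1 : ℝ) else 0) *
        (fun s => if s k = i then (1 : ℝ) else 0) = fun s => if s k = i then (1 : ℝ) else 0 := by
      ext s
      by_cases hs : s k = i <;> simp [hs]
    rw [h2, h1]
  · subst hkl
    rw [covariance_eq_sub (memLp_of_finite _ _) (memLp_of_finite _ _)]
    have h1 := fun i => h.integral_eval k (fun x => (if x = i then (1 : ℝ) else 0))
    simp only [mul_ite, mul_one, mul_zero, Finset.sum_ite_eq', Finset.mem_univ, if_true] at h1
    have h2 : (fun s : Fin m → Fin M => if s k = i then (1 : ℝ) else 0) *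
        (fun s => if s k = j then (1 : ℝ) else 0) = 0 := by
      ext s
      by_cases hs : s k = i
      · simp [hs, hij]
      · simp [hs]
    rw [h2, h1, h1]
    simp
  · have hi : iIndepFun (fun k (s : Fin m → Fin M) => s k) (clusteredLaw r) :=
      iIndepFun_pi (X := fun _ x => x) fun _ => aemeasurable_id
    exact ((hi.indepFun hkl).comp (φ := fun x => if x = i then (1 : ℝ) else 0)
      (ψ := fun x => if x = j then (1 : ℝ) else 0) Measurable.of_discrete
      Measurable.of_discrete).covariance_eq_zero (memLp_of_finite _ _) (memLp_of_finite _ _)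

/-- Distinct draws are uncorrelated, so the double sum over draws collapses to its diagonal, where
the indicators have the covariance of a single categorical variable. -/
theorem covariance_aggWeight (h : IsClusteredSampling p r) (i j : Fin M) :
    covariance (fun s => aggWeight s i) (fun s => aggWeight s j) (clusteredLaw r) =
      1 / (m : ℝ) ^ 2 * ∑ k, ((if i = j then r k i else 0) - r k i * r k j) := by
  have := h.isProbabilityMeasure_law
  unfold aggWeight
  rw [covariance_const_mul_left, covariance_const_mul_right,
    covariance_fun_sum_fun_sum (fun _ => memLp_of_finite _ _) (fun _ => memLp_of_finite _ _)]
  simp_rw [h.covariance_eval]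
  simp only [Finset.sum_ite_eq, Finset.mem_univ, if_true]
  ring

theorem integral_aggWeight (h : IsClusteredSampling p r) (hm : 0 < m) (i : Fin M) :
    ∫ s, aggWeight s i ∂(clusteredLaw r) = p i := by
  have := h.isProbabilityMeasure_law
  unfold aggWeight
  rw [integral_const_mul, integral_finsetSum _
    fun _ _ => (memLp_of_finite _ 1).integrable le_rfl]
  simp_rw [fun k => h.integral_eval k (fun x => (if x = i then (1 : ℝ) else 0))]
  simp only [mul_ite, mul_one, mul_zero, Finset.sum_ite_eq', Finset.mem_univ, if_true]
  rw [h.sum_clusters]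
  field_simp

theorem weightVar_eq (h : IsClusteredSampling p r) (i : Fin M) :
    weightVar (clusteredLaw r) i = 1 / (m : ℝ) ^ 2 * (m * p i - ∑ k, r k i ^ 2) := by
  have h1 := h.covariance_aggWeight i i
  rw [covariance_self Measurable.of_discrete.aemeasurable] at h1
  unfold weightVar
  rw [h1, ← h.sum_clusters, ← Finset.sum_sub_distrib]
  simp [sq]

theorem integral_aggWeight_mul (h : IsClusteredSampling p r) (hm : 0 < m) (i j : Fin M) :
    ∫ s, aggWeight s i * aggWeight s j ∂(clusteredLaw r) = p i * p j +
      1 / (m : ℝ) ^ 2 * ∑ k, ((if i = j then r k i else 0) - r k i * r k j) := by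
  have := h.isProbabilityMeasure_law
  have h1 := h.covariance_aggWeight i j
  rw [covariance_eq_sub (memLp_of_finite _ _) (memLp_of_finite _ _), h.integral_aggWeight hm,
    h.integral_aggWeight hm] at h1
  rw [← h1]
  simp

theorem integral_aggWeight_sq (h : IsClusteredSampling p r) (hm : 0 < m) (i : Fin M) :
    ∫ s, aggWeight s i ^ 2 ∂(clusteredLaw r) = weightVar (clusteredLaw r) i + p i ^ 2 := by
  simp_rw [sq, h.integral_aggWeight_mul hm, h.weightVar_eq, if_true, Finset.sum_sub_distrib,
    h.sum_clusters]
  ring_nf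

end IsClusteredSampling

theorem IsImportance.isClusteredSampling {M : ℕ} {p : Fin M → ℝ} (hp : IsImportance p) (m : ℕ) :
    IsClusteredSampling (m := m) p (fun _ => p) where
  nonneg _ := hp.1
  sum_clients _ := hp.2
  sum_clusters i := by simp

theorem exists_clusteredSampling_not_hasCovStructure :
    ∃ (M m : ℕ) (p : Fin M → ℝ) (r : Fin m → Fin M → ℝ),
      0 < m ∧ IsImportance p ∧ IsClusteredSampling p r ∧
      ¬ ∃ α : ℝ, HasCovStructure (clusteredLaw r) p α := by
  -- The first draw is always client 0, whose weight is therefore constant; this forces `α = 0`.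
  -- Clients 1 and 2 share the second draw and are negatively correlated, which contradicts `α = 0`.
  have h : IsClusteredSampling ![1 / 2, 1 / 4, 1 / 4] ![![1, 0, 0], ![0, 1 / 2, 1 / 2]] := by
    refine ⟨fun k i => ?_, fun k => ?_, fun i => ?_⟩
    · fin_cases k <;> fin_cases i <;> simp
    · fin_cases k <;> norm_num [Fin.sum_univ_succ]
    · fin_cases i <;> norm_num [Fin.sum_univ_succ]
  refine ⟨3, 2, _, _, by norm_num, ⟨fun i => ?_, ?_⟩, h, ?_⟩
  · fin_cases i <;> simp
  · simp [Fin.sum_univ_succ]; norm_num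
  · rintro ⟨α, hα⟩
    have h01 := hα 0 1 (by decide)
    have h12 := hα 1 2 (by decide)
    rw [h.covariance_aggWeight] at h01 h12
    simp [Fin.sum_univ_succ] at h01 h12
    rw [h01] at h12
    norm_num at h12

/-- The means `∑ₖ r k i = m p_i` agree for both schemes, so the variances differ only through `∑ₖ r
k i ^ 2`; by Cauchy-Schwarz this is smallest when `r k i` does not depend on `k`, which is MD
sampling. -/
theorem weightVar_clusteredLaw_le {M m : ℕ} {p : Fin M → ℝ} {r : Fin m → Fin M → ℝ} (hm : 0 < m)
    (hp : IsImportance p) (h : IsClusteredSampling p r) (i : Fin M) :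
    weightVar (clusteredLaw r) i ≤ weightVar (mdLaw m p) i := by
  have h2 : weightVar (mdLaw m p) i = 1 / (m : ℝ) ^ 2 * (m * p i - m * p i ^ 2) := by
    refine ((hp.isClusteredSampling m).weightVar_eq i).trans ?_
    simp
  rw [h2, h.weightVar_eq]
  have hm' : (0 : ℝ) < m := by exact_mod_cast hm
  have h3 := sq_sum_le_card_mul_sum_sq (s := Finset.univ) (f := fun k => r k i)
  rw [h.sum_clusters, Finset.card_univ, Fintype.card_fin] at h3
  have h4 : (m : ℝ) * p i ^ 2 ≤ ∑ k, r k i ^ 2 := by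
    refine le_of_mul_le_mul_left ?_ hm'
    linarith
  gcongr

theorem sum_weightVar_clusteredLaw {M m : ℕ} {p : Fin M → ℝ} {r : Fin m → Fin M → ℝ} (hm : 0 < m)
    (hp : IsImportance p) (h : IsClusteredSampling p r) :
    ∑ i, weightVar (clusteredLaw r) i =
      1 / m - 1 / (m : ℝ) ^ 2 * ∑ i, ∑ k, r k i ^ 2 := by
  simp_rw [h.weightVar_eq, mul_sub, Finset.sum_sub_distrib, ← Finset.mul_sum, hp.2]
  field_simp

theorem sum_weightVar_mdLaw {M m : ℕ} {p : Fin M → ℝ} (hm : 0 < m) (hp : IsImportance p) :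
    ∑ i, weightVar (mdLaw m p) i = 1 / m - 1 / m * ∑ i, p i ^ 2 := by
  have h := sum_weightVar_clusteredLaw hm hp (hp.isClusteredSampling m)
  simp only [Finset.sum_const, Finset.card_univ, Fintype.card_fin, nsmul_eq_mul,
    ← Finset.mul_sum] at h
  refine h.trans ?_
  field_simp

theorem sum_weightVar_mdLaw_add {M m : ℕ} {p : Fin M → ℝ} (hm : 0 < m) (hp : IsImportance p) :
    ∑ i, weightVar (mdLaw m p) i + 1 / m * ∑ i, p i ^ 2 = 1 / m := by
  rw [sum_weightVar_mdLaw hm hp]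
  ring

theorem hasCovStructure_mdLaw {M m : ℕ} {p : Fin M → ℝ} (hm : 0 < m) (hp : IsImportance p) :
    HasCovStructure (mdLaw m p) p (1 / m) := by
  intro i j hij
  refine ((hp.isClusteredSampling m).covariance_aggWeight i j).trans ?_
  simp only [hij, if_false, Finset.sum_const, Finset.card_univ, Fintype.card_fin, nsmul_eq_mul]
  field_simp
  ring

theorem sampling_quantities {M m : ℕ} (K : ℕ) {p : Fin M → ℝ} {r : Fin m → Fin M → ℝ}
    (hm : 0 < m) (hp : IsImportance p) (h : IsClusteredSampling p r) :
    (∀ i, weightVar (clusteredLaw r) i ≤ weightVar (mdLaw m p) i) ∧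
      termA (clusteredLaw r) p =
        m * (1 / m - 1 / (m : ℝ) ^ 2 * ∑ i, ∑ k, r k i ^ 2 + ∑ i, p i ^ 2) ∧
      termA (clusteredLaw r) p ≤ termA (mdLaw m p) p ∧
      HasCovStructure (mdLaw m p) p (1 / m) ∧
      termE K (mdLaw m p) p (1 / m) = ((K : ℝ) - 1) / m ∧
      termF K (mdLaw m p) p (1 / m) = (K : ℝ) / m := by
  refine ⟨weightVar_clusteredLaw_le hm hp h, ?_, ?_, hasCovStructure_mdLaw hm hp, ?_, ?_⟩
  · rw [termA, Finset.sum_add_distrib, sum_weightVar_clusteredLaw hm hp h]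
  · unfold termA
    gcongr with i
    exact weightVar_clusteredLaw_le hm hp h i
  · rw [termE, sum_weightVar_mdLaw_add hm hp, mul_one_div]
  · rw [termF, sum_weightVar_mdLaw_add hm hp, mul_one_div]

/-! ### Freezing one of two independent variables; orthogonality in `L²`. -/

section Independence

variable {Ω α β E : Type*} [MeasurableSpace Ω] [MeasurableSpace α] [MeasurableSpace β]
  {P : Measure Ω} [IsProbabilityMeasure P] {Y : Ω → α} {Z : Ω → β}

theorem lintegral_indepFun_prodMk (h : IndepFun Y Z P) (hY : Measurable Y) (hZ : Measurable Z)
    {F : α × β → ENNReal} (hF : Measurable F) :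
    ∫⁻ w, F (Y w, Z w) ∂P = ∫⁻ w, ∫⁻ w', F (Y w, Z w') ∂P ∂P := by
  have : IsProbabilityMeasure (P.map Z) := Measure.isProbabilityMeasure_map hZ.aemeasurable
  rw [← lintegral_map hF (hY.prodMk hZ),
    (indepFun_iff_map_prod_eq_prod_map_map hY.aemeasurable hZ.aemeasurable).1 h,
    lintegral_prod _ hF.aemeasurable, lintegral_map hF.lintegral_prod_right' hY]
  refine lintegral_congr fun w => ?_
  exact lintegral_map (hF.comp measurable_prodMk_left) hZ

variable [NormedAddCommGroup E]

theorem integral_indepFun_prodMk [NormedSpace ℝ E] (h : IndepFun Y Z P) (hY : Measurable Y)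
    (hZ : Measurable Z)
    {F : α × β → E} (hF : StronglyMeasurable F) (hi : Integrable (fun w => F (Y w, Z w)) P) :
    ∫ w, F (Y w, Z w) ∂P = ∫ w, ∫ w', F (Y w, Z w') ∂P ∂P := by
  have : IsProbabilityMeasure (P.map Y) := Measure.isProbabilityMeasure_map hY.aemeasurable
  have : IsProbabilityMeasure (P.map Z) := Measure.isProbabilityMeasure_map hZ.aemeasurable
  have hmap := (indepFun_iff_map_prod_eq_prod_map_map hY.aemeasurable hZ.aemeasurable).1 h
  have hi' : Integrable F ((P.map Y).prod (P.map Z)) := by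
    rw [← hmap]
    exact (integrable_map_measure hF.aestronglyMeasurable (hY.prodMk hZ).aemeasurable).2 hi
  rw [← integral_map (f := F) (hY.prodMk hZ).aemeasurable hF.aestronglyMeasurable, hmap,
    integral_prod _ hi', integral_map hY.aemeasurable
      hF.integral_prod_right'.aestronglyMeasurable]
  refine integral_congr_ae (Filter.Eventually.of_forall fun w => ?_)
  exact integral_map hZ.aemeasurable
    (hF.comp_measurable measurable_prodMk_left).aestronglyMeasurable

/-- A second moment bound uniform in the frozen variable survives when that variable is random. The
bound is first obtained for the extended integral, so no integrability of the composite has to be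
assumed. It is what carries the variance bound at a fixed model over to the random local iterates.
-/
theorem memLp_two_indepFun_prodMk (h : IndepFun Y Z P) (hY : Measurable Y)
    (hZ : Measurable Z) {F : α × β → E} (hF : StronglyMeasurable F) {s : ℝ}
    (hL : ∀ y, MemLp (fun w => F (y, Z w)) 2 P) (hs : ∀ y, ∫ w, ‖F (y, Z w)‖ ^ 2 ∂P ≤ s) :
    MemLp (fun w => F (Y w, Z w)) 2 P ∧ ∫ w, ‖F (Y w, Z w)‖ ^ 2 ∂P ≤ s := by
  have hm : StronglyMeasurable fun w => F (Y w, Z w) := hF.comp_measurable (hY.prodMk hZ)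
  have hle : ∫⁻ w, ENNReal.ofReal (‖F (Y w, Z w)‖ ^ 2) ∂P ≤ ENNReal.ofReal s := by
    rw [lintegral_indepFun_prodMk h hY hZ (F := fun q => ENNReal.ofReal (‖F q‖ ^ 2))
      (hF.norm.pow 2).measurable.ennreal_ofReal]
    calc _ ≤ ∫⁻ _, ENNReal.ofReal s ∂P := by
          refine lintegral_mono fun w => ?_
          rw [← ofReal_integral_eq_lintegral_ofReal ((memLp_two_iff_integrable_sq_norm
            (hL (Y w)).1).1 (hL (Y w))) (Filter.Eventually.of_forall fun _ => by positivity)]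
          exact ENNReal.ofReal_le_ofReal (hs _)
      _ = _ := by simp
  have hs0 : 0 ≤ s := by
    obtain ⟨w⟩ := P.nonempty_of_neZero
    exact (integral_nonneg fun _ => by positivity).trans (hs (Y w))
  have hint : Integrable (fun w => ‖F (Y w, Z w)‖ ^ 2) P := by
    refine ⟨(hm.norm.pow 2).aestronglyMeasurable, ?_⟩
    rw [hasFiniteIntegral_iff_ofReal (Filter.Eventually.of_forall fun _ => by positivity)]
    exact hle.trans_lt ENNReal.ofReal_lt_top
  refine ⟨(memLp_two_iff_integrable_sq_norm hm.aestronglyMeasurable).2 hint, ?_⟩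
  rw [← ENNReal.ofReal_le_ofReal_iff hs0, ofReal_integral_eq_lintegral_ofReal hint
    (Filter.Eventually.of_forall fun _ => by positivity)]
  exact hle

omit [IsProbabilityMeasure P] in
theorem integrable_inner_of_memLp_two [InnerProductSpace ℝ E] {X X' : Ω → E} (hX : MemLp X 2 P)
    (hX' : MemLp X' 2 P) : Integrable (fun w => inner ℝ (X w) (X' w)) P := by
  have hm : AEStronglyMeasurable (fun w => inner ℝ (X w) (X' w)) P := hX.1.inner hX'.1
  have h1 := (memLp_two_iff_integrable_sq_norm hX.1).1 hX
  have h2 := (memLp_two_iff_integrable_sq_norm hX'.1).1 hX'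
  refine (h1.add h2).mono' hm (Filter.Eventually.of_forall fun w => ?_)
  have := norm_inner_le_norm (𝕜 := ℝ) (X w) (X' w)
  simp only [Pi.add_apply]
  nlinarith [sq_nonneg (‖X w‖ - ‖X' w‖), sq_nonneg (‖X w‖), sq_nonneg ‖X' w‖]

omit [IsProbabilityMeasure P] in
theorem integrable_norm_sq_of_memLp_two {X : Ω → E} (hX : MemLp X 2 P) :
    Integrable (fun w => ‖X w‖ ^ 2) P := (memLp_two_iff_integrable_sq_norm hX.1).1 hX

omit [IsProbabilityMeasure P] in
theorem integral_norm_add_sq_of_orthogonal [InnerProductSpace ℝ E] {X X' : Ω → E} (hX : MemLp X 2 P)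
    (hX' : MemLp X' 2 P) (h0 : ∫ w, inner ℝ (X w) (X' w) ∂P = 0) :
    ∫ w, ‖X w + X' w‖ ^ 2 ∂P = ∫ w, ‖X w‖ ^ 2 ∂P + ∫ w, ‖X' w‖ ^ 2 ∂P := by
  have hi := integrable_inner_of_memLp_two hX hX'
  have h1 := integrable_norm_sq_of_memLp_two hX
  have h2 := integrable_norm_sq_of_memLp_two hX'
  have h3 : Integrable (fun w => ‖X w‖ ^ 2 + 2 * inner ℝ (X w) (X' w)) P := h1.add (hi.const_mul 2)
  simp_rw [norm_add_sq_real]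
  rw [integral_add h3 h2,
    integral_add h1 (hi.const_mul 2), integral_const_mul, h0]
  ring

/-- Two independent square integrable vectors, one of them centred, are orthogonal, also when the
centred one depends on the other through a measurable kernel. -/
theorem integral_inner_indepFun_eq_zero [InnerProductSpace ℝ E] [CompleteSpace E]
    (h : IndepFun Y Z P) (hY : Measurable Y)
    (hZ : Measurable Z) {f : α → E} (hf : StronglyMeasurable f) (hfL : MemLp (fun w => f (Y w)) 2 P)
    {F : α × β → E} (hF : StronglyMeasurable F)
    (hL : ∀ y, MemLp (fun w => F (y, Z w)) 2 P) (hFL : MemLp (fun w => F (Y w, Z w)) 2 P)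
    (h0 : ∀ y, ∫ w, F (y, Z w) ∂P = 0) :
    ∫ w, inner ℝ (f (Y w)) (F (Y w, Z w)) ∂P = 0 := by
  rw [integral_indepFun_prodMk h hY hZ (F := fun q => inner ℝ (f q.1) (F q))
    ((hf.comp_measurable measurable_fst).inner hF) (integrable_inner_of_memLp_two hfL hFL)]
  have : ∀ w, ∫ w', inner ℝ (f (Y w)) (F (Y w, Z w')) ∂P = 0 := fun w => by
    rw [integral_inner ((hL (Y w)).integrable one_le_two), h0, inner_zero_right]
  simp [this]

end Independence

/-! ### Local SGD of one client: splitting into drift and noise, and the noise moments. -/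

section LocalSGD

variable {d : ℕ} {Ω Ξ : Type*} [MeasurableSpace Ω] [MeasurableSpace Ξ]

/-- The accumulated deviation of the stochastic gradients from `G` in the first `k` local steps. -/
def sgdNoise (g : Model d → Ξ → Model d) (G : Model d → Model d) (ηl : ℝ) (θ : Model d)
    (b : ℕ → Ξ) (k : ℕ) : Model d :=
  ∑ j ∈ Finset.range k, (g (localSGD g ηl θ b j) (b j) - G (localSGD g ηl θ b j))

/-- The accumulated true gradients in the first `k` local steps. -/
def sgdDrift (g : Model d → Ξ → Model d) (G : Model d → Model d) (ηl : ℝ) (θ : Model d)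
    (b : ℕ → Ξ) (k : ℕ) : Model d :=
  ∑ j ∈ Finset.range k, G (localSGD g ηl θ b j)

omit [MeasurableSpace Ξ] in
theorem localSGD_sub_eq (g : Model d → Ξ → Model d) (G : Model d → Model d) (ηl : ℝ)
    (θ : Model d) (b : ℕ → Ξ) (k : ℕ) :
    localSGD g ηl θ b k - θ = -ηl • (sgdDrift g G ηl θ b k + sgdNoise g G ηl θ b k) := by
  induction k with
  | zero => simp [localSGD, sgdDrift, sgdNoise]
  | succ k ih =>
    have : localSGD g ηl θ b (k + 1) - θ =
        (localSGD g ηl θ b k - θ) - ηl • g (localSGD g ηl θ b k) (b k) := by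
      rw [localSGD]; abel
    rw [this, ih, sgdDrift, sgdNoise, sgdDrift, sgdNoise, Finset.sum_range_succ,
      Finset.sum_range_succ]
    module

/-- The σ-algebra is a variable and only the batches before step `k` are required to be measurable,
so that the lemma also applies to the σ-algebra generated by those past batches. -/
theorem measurable_localSGD {Ω : Type*} {mΩ : MeasurableSpace Ω} {g : Model d → Ξ → Model d} (hg : Measurable (Function.uncurry g))
    (ηl : ℝ) {θ : Ω → Model d} (hθ : Measurable θ) {b : ℕ → Ω → Ξ} {k : ℕ}
    (hb : ∀ j < k, Measurable (b j)) :
    Measurable fun w => localSGD g ηl (θ w) (fun j => b j w) k := by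
  induction k with
  | zero => exact hθ
  | succ k ih =>
    have h1 := ih fun j hj => hb j (hj.trans k.lt_succ_self)
    exact h1.sub ((hg.comp (h1.prodMk (hb k k.lt_succ_self))).const_smul ηl)

theorem measurable_sgdNoise {Ω : Type*} {mΩ : MeasurableSpace Ω} {g : Model d → Ξ → Model d} (hg : Measurable (Function.uncurry g))
    {G : Model d → Model d} (hG : Measurable G) (ηl : ℝ) (θ : Model d) {b : ℕ → Ω → Ξ} {k : ℕ}
    (hb : ∀ j < k, Measurable (b j)) :
    Measurable fun w => sgdNoise g G ηl θ (fun j => b j w) k := by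
  refine Finset.measurable_sum _ fun j hj => ?_
  have hj := Finset.mem_range.1 hj
  have h1 : Measurable fun w => localSGD g ηl θ (fun j => b j w) j :=
    measurable_localSGD hg ηl measurable_const fun l hl => hb l (hl.trans hj)
  exact (hg.comp (h1.prodMk (hb j hj))).sub (hG.comp h1)

variable {P : Measure Ω} [IsProbabilityMeasure P]

/-- `g` evaluated on the independent batches `ζ` is an unbiased estimate of `G`, of variance at
most `s`. -/
structure IsUnbiasedOracle (P : Measure Ω) (g : Model d → Ξ → Model d) (G : Model d → Model d)
    (ζ : ℕ → Ω → Ξ) (s : ℝ) : Prop where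
  measurable_g : Measurable (Function.uncurry g)
  measurable_G : Measurable G
  measurable_ζ : ∀ k, Measurable (ζ k)
  indep : iIndepFun ζ P
  memLp : ∀ k x, MemLp (fun w => g x (ζ k w)) 2 P
  mean : ∀ k x, ∫ w, g x (ζ k w) ∂P = G x
  var : ∀ k x, ∫ w, ‖g x (ζ k w) - G x‖ ^ 2 ∂P ≤ s

namespace IsUnbiasedOracle

variable {g : Model d → Ξ → Model d} {G : Model d → Model d} {ζ : ℕ → Ω → Ξ} {s : ℝ}

theorem memLp_sub (h : IsUnbiasedOracle P g G ζ s) (k : ℕ) (x : Model d) :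
    MemLp (fun w => g x (ζ k w) - G x) 2 P := (h.memLp k x).sub (memLp_const _)

theorem integral_sub_eq_zero (h : IsUnbiasedOracle P g G ζ s) (k : ℕ) (x : Model d) :
    ∫ w, (g x (ζ k w) - G x) ∂P = 0 := by
  rw [integral_sub ((h.memLp k x).integrable one_le_two) (integrable_const _), h.mean]
  simp

-- The iterate and the noise accumulated before step `k` are functions of the batches with index
-- below `k`, a block disjoint from `{k}`.
omit [IsProbabilityMeasure P] in
theorem indepFun_past (h : IsUnbiasedOracle P g G ζ s) (ηl : ℝ) (θ : Model d) (k : ℕ) :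
    IndepFun (fun w => (localSGD g ηl θ (fun j => ζ j w) k, sgdNoise g G ηl θ (fun j => ζ j w) k))
      (ζ k) P := by
  have hi : Indep (⨆ j ∈ Set.Iio k, MeasurableSpace.comap (ζ j) inferInstance)
      (⨆ j ∈ ({k} : Set ℕ), MeasurableSpace.comap (ζ j) inferInstance) P :=
    indep_iSup_of_disjoint (fun j => (h.measurable_ζ j).comap_le)
      ((iIndepFun_iff_iIndep _ _ _).1 h.indep) (by simp)
  rw [IndepFun_iff_Indep]
  refine indep_of_indep_of_le hi ?_ (by simp)
  have hb : ∀ j < k, Measurable[⨆ j ∈ Set.Iio k, MeasurableSpace.comap (ζ j) inferInstance]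
      (ζ j) := fun j hj =>
    (comap_measurable (ζ j)).mono (le_iSup₂_of_le j hj le_rfl) le_rfl
  rw [← measurable_iff_comap_le]
  exact (measurable_localSGD h.measurable_g ηl measurable_const hb).prodMk
    (measurable_sgdNoise h.measurable_g h.measurable_G ηl θ hb)

omit [IsProbabilityMeasure P] in
theorem indepFun_localSGD (h : IsUnbiasedOracle P g G ζ s) (ηl : ℝ) (θ : Model d) (k : ℕ) :
    IndepFun (fun w => localSGD g ηl θ (fun j => ζ j w) k) (ζ k) P :=
  (h.indepFun_past ηl θ k).comp measurable_fst measurable_id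

theorem memLp_noise_step (h : IsUnbiasedOracle P g G ζ s) (ηl : ℝ) (θ : Model d) (k : ℕ) :
    MemLp (fun w => g (localSGD g ηl θ (fun j => ζ j w) k) (ζ k w) -
        G (localSGD g ηl θ (fun j => ζ j w) k)) 2 P ∧
      ∫ w, ‖g (localSGD g ηl θ (fun j => ζ j w) k) (ζ k w) -
        G (localSGD g ηl θ (fun j => ζ j w) k)‖ ^ 2 ∂P ≤ s := by
  have hi := h.indepFun_localSGD ηl θ k
  exact memLp_two_indepFun_prodMk (F := fun q : Model d × Ξ => g q.1 q.2 - G q.1) hi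
    (measurable_localSGD h.measurable_g ηl measurable_const fun j _ => h.measurable_ζ j)
    (h.measurable_ζ k)
    (h.measurable_g.sub (h.measurable_G.comp measurable_fst)).stronglyMeasurable
    (h.memLp_sub k) (h.var k)

theorem memLp_noise (h : IsUnbiasedOracle P g G ζ s) (ηl : ℝ) (θ : Model d) (k : ℕ) :
    MemLp (fun w => sgdNoise g G ηl θ (fun j => ζ j w) k) 2 P :=
  memLp_finsetSum _ fun j _ => (h.memLp_noise_step ηl θ j).1

theorem integral_noise_step (h : IsUnbiasedOracle P g G ζ s) (ηl : ℝ) (θ : Model d) (k : ℕ) :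
    ∫ w, (g (localSGD g ηl θ (fun j => ζ j w) k) (ζ k w) -
        G (localSGD g ηl θ (fun j => ζ j w) k)) ∂P = 0 := by
  have hi := h.indepFun_localSGD ηl θ k
  rw [integral_indepFun_prodMk (F := fun q : Model d × Ξ => g q.1 q.2 - G q.1) hi
    (measurable_localSGD h.measurable_g ηl measurable_const fun j _ => h.measurable_ζ j)
    (h.measurable_ζ k)
    (h.measurable_g.sub (h.measurable_G.comp measurable_fst)).stronglyMeasurable
    ((h.memLp_noise_step ηl θ k).1.integrable one_le_two)]
  simp [h.integral_sub_eq_zero]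

theorem integral_noise (h : IsUnbiasedOracle P g G ζ s) (ηl : ℝ) (θ : Model d) (k : ℕ) :
    ∫ w, sgdNoise g G ηl θ (fun j => ζ j w) k ∂P = 0 := by
  unfold sgdNoise
  rw [integral_finsetSum _ fun j _ => (h.memLp_noise_step ηl θ j).1.integrable one_le_two]
  exact Finset.sum_eq_zero fun j _ => h.integral_noise_step ηl θ j

/-- The noise is a martingale: each increment is centred given the past, hence orthogonal to the
accumulated sum. This gives growth linear in `k` instead of quadratic. -/
theorem integral_norm_noise_sq_le (h : IsUnbiasedOracle P g G ζ s) (ηl : ℝ) (θ : Model d)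
    (k : ℕ) : ∫ w, ‖sgdNoise g G ηl θ (fun j => ζ j w) k‖ ^ 2 ∂P ≤ k * s := by
  induction k with
  | zero => simp [sgdNoise]
  | succ k ih =>
    have hstep := h.memLp_noise_step ηl θ k
    have horth := integral_inner_indepFun_eq_zero
      (F := fun q : (Model d × Model d) × Ξ => g q.1.1 q.2 - G q.1.1) (f := Prod.snd)
      (h.indepFun_past ηl θ k)
      ((measurable_localSGD h.measurable_g ηl measurable_const fun j _ => h.measurable_ζ j).prodMk
        (measurable_sgdNoise h.measurable_g h.measurable_G ηl θ fun j _ => h.measurable_ζ j))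
      (h.measurable_ζ k) measurable_snd.stronglyMeasurable (h.memLp_noise ηl θ k)
      ((h.measurable_g.comp ((measurable_fst.comp measurable_fst).prodMk measurable_snd)).sub
        (h.measurable_G.comp (measurable_fst.comp measurable_fst))).stronglyMeasurable
      (fun y => h.memLp_sub k y.1) hstep.1
      (fun y => h.integral_sub_eq_zero k y.1)
    have hadd := integral_norm_add_sq_of_orthogonal (h.memLp_noise ηl θ k) hstep.1 horth
    simp only [sgdNoise, Finset.sum_range_succ] at hadd ih ⊢
    rw [hadd]
    push_cast
    linarith [hstep.2]

end IsUnbiasedOracle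

end LocalSGD

/-! ### Mean square displacement of the local models. -/

/-- Bounding every partial sum in the recursion by the total `V` makes `v k` at most `k` times a
common quantity, and `∑ k = K (K - 1) / 2` produces the factor that vanishes for a single local
step. The resulting inequality for `V` is then solved by absorption. -/
theorem sum_sq_drift_le_of_recursion {v : ℕ → ℝ} (hv : ∀ k, 0 ≤ v k) {K : ℕ} (hK : 0 < K)
    {η L s γ : ℝ} (hγ : 0 ≤ γ)
    (hrec : ∀ k < K, v k ≤
      2 * η ^ 2 * (k * ∑ j ∈ Finset.range k, (2 * L ^ 2 * v j + 2 * γ) + k * s))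
    (hsmall : 4 * (η * L * K) ^ 2 ≤ 1) :
    ∑ k ∈ Finset.range K, v k ≤ 2 * η ^ 2 * (K * (K - 1)) * (s + 2 * K * γ) := by
  set V := ∑ k ∈ Finset.range K, v k with hV
  have hV0 : 0 ≤ V := Finset.sum_nonneg fun k _ => hv k
  have hK1 : (1 : ℝ) ≤ K := by exact_mod_cast hK
  have h1 : ∀ k ∈ Finset.range K, v k ≤ (k : ℝ) * (2 * η ^ 2 * (2 * L ^ 2 * V + 2 * K * γ + s)) := by
    intro k hk
    refine (hrec k (Finset.mem_range.1 hk)).trans ?_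
    have h2 : ∑ j ∈ Finset.range k, (2 * L ^ 2 * v j + 2 * γ) ≤ 2 * L ^ 2 * V + 2 * K * γ := by
      calc _ ≤ ∑ j ∈ Finset.range K, (2 * L ^ 2 * v j + 2 * γ) :=
            Finset.sum_le_sum_of_subset_of_nonneg
              (Finset.range_mono (Finset.mem_range.1 hk).le)
              fun j _ _ => by have := hv j; positivity
        _ = _ := by
            rw [Finset.sum_add_distrib, ← Finset.mul_sum, Finset.sum_const, Finset.card_range,
              nsmul_eq_mul]
            ring
    calc _ ≤ 2 * η ^ 2 * (k * (2 * L ^ 2 * V + 2 * K * γ) + k * s) := by gcongr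
      _ = _ := by ring
  have h3 : V ≤ ((K : ℝ) * (K - 1) / 2) * (2 * η ^ 2 * (2 * L ^ 2 * V + 2 * K * γ + s)) := by
    refine (Finset.sum_le_sum h1).trans_eq ?_
    rw [← Finset.sum_mul]
    congr 1
    have h4 := Finset.sum_range_id_mul_two K
    have h5 : (∑ i ∈ Finset.range K, (i : ℝ)) * 2 = K * (K - 1) := by
      rw [← Nat.cast_pred hK, ← Nat.cast_mul, ← h4]
      push_cast
      rfl
    linarith
  -- The coefficient of `V` on the right of `h3` is half of this left-hand side, so at most `1/2`;
  -- absorbing it on the left costs a factor 2.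
  have h6 : η ^ 2 * (K * (K - 1)) * (4 * L ^ 2) ≤ 1 := by
    refine le_trans ?_ hsmall
    have : (K : ℝ) * (K - 1) ≤ K ^ 2 := by nlinarith
    calc _ ≤ η ^ 2 * K ^ 2 * (4 * L ^ 2) := by gcongr
      _ = _ := by ring
  nlinarith [mul_le_mul_of_nonneg_right h6 hV0]

theorem norm_sum_sq_le_card_mul {ι E : Type*} [NormedAddCommGroup E] (t : Finset ι) (x : ι → E) :
    ‖∑ j ∈ t, x j‖ ^ 2 ≤ t.card * ∑ j ∈ t, ‖x j‖ ^ 2 :=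
  (pow_le_pow_left₀ (norm_nonneg _) (norm_sum_le _ _) 2).trans sq_sum_le_card_mul_sum_sq

theorem norm_add_sq_le_two_mul {E : Type*} [NormedAddCommGroup E] (x y : E) :
    ‖x + y‖ ^ 2 ≤ 2 * ‖x‖ ^ 2 + 2 * ‖y‖ ^ 2 := by
  have := pow_le_pow_left₀ (norm_nonneg _) (norm_add_le x y) 2
  nlinarith [sq_nonneg (‖x‖ - ‖y‖)]

section LocalSGD

variable {d : ℕ} {Ω Ξ : Type*} [MeasurableSpace Ω] [MeasurableSpace Ξ]
  {P : Measure Ω} [IsProbabilityMeasure P]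

theorem norm_sq_le_of_lipschitz {G : Model d → Model d} {L : ℝ}
    (hG : ∀ x y, ‖G x - G y‖ ≤ L * ‖x - y‖) (x θ : Model d) :
    ‖G x‖ ^ 2 ≤ 2 * L ^ 2 * ‖x - θ‖ ^ 2 + 2 * ‖G θ‖ ^ 2 := by
  have h := norm_add_sq_le_two_mul (G x - G θ) (G θ)
  have h2 := pow_le_pow_left₀ (norm_nonneg _) (hG x θ) 2
  rw [sub_add_cancel] at h
  nlinarith

namespace IsUnbiasedOracle

variable {g : Model d → Ξ → Model d} {G : Model d → Model d} {ζ : ℕ → Ω → Ξ} {s L : ℝ}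

theorem memLp_grad_of_memLp {G : Model d → Model d} (hGm : Measurable G)
    (hG : ∀ x y, ‖G x - G y‖ ≤ L * ‖x - y‖) {X : Ω → Model d} (θ : Model d)
    (hX : MemLp (fun w => X w - θ) 2 P) : MemLp (fun w => G (X w)) 2 P := by
  have hXm : AEMeasurable X P := by
    have := hX.1.aemeasurable.add_const θ
    simpa using this
  have h1 : MemLp (fun w => L * ‖X w - θ‖ + ‖G θ‖) 2 P :=
    (hX.norm.const_mul L).add (memLp_const _)
  refine h1.mono (hGm.comp_aemeasurable hXm).aestronglyMeasurable
    (Filter.Eventually.of_forall fun w => ?_)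
  refine le_trans ?_ (le_abs_self _)
  have := norm_add_le (G (X w) - G θ) (G θ)
  rw [sub_add_cancel] at this
  linarith [hG (X w) θ]

theorem memLp_localSGD_sub (h : IsUnbiasedOracle P g G ζ s)
    (hG : ∀ x y, ‖G x - G y‖ ≤ L * ‖x - y‖) (ηl : ℝ) (θ : Model d) (k : ℕ) :
    MemLp (fun w => localSGD g ηl θ (fun j => ζ j w) k - θ) 2 P := by
  induction k with
  | zero => simp [localSGD]
  | succ k ih =>
    have h1 := (h.memLp_noise_step ηl θ k).1
    have h2 := memLp_grad_of_memLp h.measurable_G hG θ ih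
    refine (ih.sub ((h1.add h2).const_smul ηl)).ae_eq (Filter.Eventually.of_forall fun w => ?_)
    simp only [Pi.sub_apply, Pi.add_apply, Pi.smul_apply, sub_add_cancel, localSGD]
    abel

theorem memLp_grad (h : IsUnbiasedOracle P g G ζ s)
    (hG : ∀ x y, ‖G x - G y‖ ≤ L * ‖x - y‖) (ηl : ℝ) (θ : Model d) (k : ℕ) :
    MemLp (fun w => G (localSGD g ηl θ (fun j => ζ j w) k)) 2 P :=
  memLp_grad_of_memLp h.measurable_G hG θ (h.memLp_localSGD_sub hG ηl θ k)

theorem memLp_drift (h : IsUnbiasedOracle P g G ζ s)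
    (hG : ∀ x y, ‖G x - G y‖ ≤ L * ‖x - y‖) (ηl : ℝ) (θ : Model d) (k : ℕ) :
    MemLp (fun w => sgdDrift g G ηl θ (fun j => ζ j w) k) 2 P :=
  memLp_finsetSum _ fun j _ => h.memLp_grad hG ηl θ j

theorem integral_norm_drift_sq_le (h : IsUnbiasedOracle P g G ζ s)
    (hG : ∀ x y, ‖G x - G y‖ ≤ L * ‖x - y‖) (ηl : ℝ) (θ : Model d) (k : ℕ) :
    ∫ w, ‖sgdDrift g G ηl θ (fun j => ζ j w) k‖ ^ 2 ∂P ≤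
      k * ∑ j ∈ Finset.range k, (2 * L ^ 2 *
        ∫ w, ‖localSGD g ηl θ (fun j => ζ j w) j - θ‖ ^ 2 ∂P + 2 * ‖G θ‖ ^ 2) := by
  have hi : ∀ j, Integrable (fun w => ‖localSGD g ηl θ (fun j => ζ j w) j - θ‖ ^ 2) P :=
    fun j => integrable_norm_sq_of_memLp_two (h.memLp_localSGD_sub hG ηl θ j)
  have hi' : ∀ j, Integrable (fun w => 2 * L ^ 2 * ‖localSGD g ηl θ (fun j => ζ j w) j - θ‖ ^ 2 +
      2 * ‖G θ‖ ^ 2) P := fun j => ((hi j).const_mul _).add (integrable_const _)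
  calc _ ≤ ∫ w, (k : ℝ) * ∑ j ∈ Finset.range k, (2 * L ^ 2 *
        ‖localSGD g ηl θ (fun j => ζ j w) j - θ‖ ^ 2 + 2 * ‖G θ‖ ^ 2) ∂P := by
        refine integral_mono (integrable_norm_sq_of_memLp_two (h.memLp_drift hG ηl θ k))
          ((integrable_finsetSum _ fun j _ => hi' j).const_mul _) fun w => ?_
        refine (norm_sum_sq_le_card_mul _ _).trans ?_
        rw [Finset.card_range]
        gcongr
        exact norm_sq_le_of_lipschitz hG _ _
    _ = _ := by
        rw [integral_const_mul, integral_finsetSum _ fun j _ => hi' j]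
        congr 1
        refine Finset.sum_congr rfl fun j _ => ?_
        rw [integral_add ((hi j).const_mul _) (integrable_const _), integral_const_mul]
        simp

theorem sum_integral_norm_localSGD_sub_sq_le (h : IsUnbiasedOracle P g G ζ s)
    (hG : ∀ x y, ‖G x - G y‖ ≤ L * ‖x - y‖) {ηl : ℝ} (θ : Model d) {K : ℕ} (hK : 0 < K)
    (hsmall : 4 * (ηl * L * K) ^ 2 ≤ 1) :
    ∑ k ∈ Finset.range K, ∫ w, ‖localSGD g ηl θ (fun j => ζ j w) k - θ‖ ^ 2 ∂P ≤
      2 * ηl ^ 2 * (K * (K - 1)) * (s + 2 * K * ‖G θ‖ ^ 2) := by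
  refine sum_sq_drift_le_of_recursion (L := L)
    (v := fun k => ∫ w, ‖localSGD g ηl θ (fun j => ζ j w) k - θ‖ ^ 2 ∂P)
    (fun k => integral_nonneg fun _ => by positivity) hK (by positivity)
    (fun k _ => ?_) hsmall
  have hD := integrable_norm_sq_of_memLp_two (h.memLp_drift hG ηl θ k)
  have hN := integrable_norm_sq_of_memLp_two (h.memLp_noise ηl θ k)
  calc _ ≤ ∫ w, (2 * ηl ^ 2 * ‖sgdDrift g G ηl θ (fun j => ζ j w) k‖ ^ 2 +
        2 * ηl ^ 2 * ‖sgdNoise g G ηl θ (fun j => ζ j w) k‖ ^ 2) ∂P := by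
        refine integral_mono (integrable_norm_sq_of_memLp_two (h.memLp_localSGD_sub hG ηl θ k))
          ((hD.const_mul _).add (hN.const_mul _)) fun w => ?_
        simp only
        rw [localSGD_sub_eq g G, norm_smul, mul_pow, norm_neg, Real.norm_eq_abs, sq_abs]
        have := norm_add_sq_le_two_mul (sgdDrift g G ηl θ (fun j => ζ j w) k)
          (sgdNoise g G ηl θ (fun j => ζ j w) k)
        nlinarith [sq_nonneg ηl]
    _ = 2 * ηl ^ 2 * (∫ w, ‖sgdDrift g G ηl θ (fun j => ζ j w) k‖ ^ 2 ∂P +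
        ∫ w, ‖sgdNoise g G ηl θ (fun j => ζ j w) k‖ ^ 2 ∂P) := by
        rw [integral_add (hD.const_mul _) (hN.const_mul _), integral_const_mul,
          integral_const_mul]
        ring
    _ ≤ _ := by
        gcongr
        · exact h.integral_norm_drift_sq_le hG ηl θ k
        · exact h.integral_norm_noise_sq_le ηl θ k

end IsUnbiasedOracle

end LocalSGD

/-! ### Second moments of sums weighted by a clustered sample. -/

section Aggregation

variable {d M m : ℕ} {Ω : Type*} [MeasurableSpace Ω] {P : Measure Ω} [IsProbabilityMeasure P]
  {p : Fin M → ℝ} {r : Fin m → Fin M → ℝ} {S : Ω → Fin m → Fin M}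

theorem norm_sum_smul_sq (q : Fin M → ℝ) (x : Fin M → Model d) :
    ‖∑ i, q i • x i‖ ^ 2 = ∑ i, ∑ j, q i * q j * inner ℝ (x i) (x j) := by
  rw [← real_inner_self_eq_norm_sq, sum_inner]
  simp_rw [inner_sum, real_inner_smul_left, real_inner_smul_right]
  refine Finset.sum_congr rfl fun i _ => Finset.sum_congr rfl fun j _ => ?_
  ring

theorem norm_sum_smul_sq_le {q : Fin M → ℝ} (hq : IsImportance q) (x : Fin M → Model d) :
    ‖∑ i, q i • x i‖ ^ 2 ≤ ∑ i, q i * ‖x i‖ ^ 2 := by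
  have hc : ConvexOn ℝ Set.univ fun y : Model d => ‖y‖ ^ 2 :=
    (convexOn_norm convex_univ).pow (fun _ _ => norm_nonneg _) 2
  simpa using hc.map_sum_le (t := Finset.univ) (w := q) (p := x) (fun i _ => hq.1 i) hq.2
    (fun _ _ => Set.mem_univ _)

theorem aggWeight_nonneg (s : Fin m → Fin M) (i : Fin M) : 0 ≤ aggWeight s i := by
  unfold aggWeight
  have : 0 ≤ ∑ k, (if s k = i then (1 : ℝ) else 0) :=
    Finset.sum_nonneg fun k _ => by split_ifs <;> norm_num
  positivity

theorem aggWeight_le_one (s : Fin m → Fin M) (i : Fin M) : aggWeight s i ≤ 1 := by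
  unfold aggWeight
  have h : ∑ k, (if s k = i then (1 : ℝ) else 0) ≤ ∑ _k : Fin m, (1 : ℝ) :=
    Finset.sum_le_sum fun k _ => by split_ifs <;> norm_num
  simp only [Finset.sum_const, Finset.card_univ, Fintype.card_fin, nsmul_eq_mul, mul_one] at h
  rw [one_div_mul_eq_div]
  exact div_le_one_of_le₀ h (Nat.cast_nonneg m)

omit [IsProbabilityMeasure P] in
theorem memLp_aggWeight_smul (hS : Measurable S) {X : Ω → Model d} (hX : MemLp X 2 P)
    (i : Fin M) : MemLp (fun w => aggWeight (S w) i • X w) 2 P := by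
  have hm : Measurable fun w => aggWeight (S w) i :=
    (Measurable.of_discrete (f := fun s : Fin m → Fin M => aggWeight s i)).comp hS
  refine hX.mono (hm.aestronglyMeasurable.smul hX.1) (Filter.Eventually.of_forall fun w => ?_)
  rw [norm_smul, Real.norm_of_nonneg (aggWeight_nonneg _ _)]
  exact mul_le_of_le_one_left (norm_nonneg _) (aggWeight_le_one _ _)

omit [IsProbabilityMeasure P] in
theorem integral_norm_sum_smul_sq (q : Fin M → ℝ) {X : Fin M → Ω → Model d}
    (hX : ∀ i, MemLp (X i) 2 P) :
    ∫ w, ‖∑ i, q i • X i w‖ ^ 2 ∂P =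
      ∑ i, ∑ j, q i * q j * ∫ w, inner ℝ (X i w) (X j w) ∂P := by
  have hi := fun i j => (integrable_inner_of_memLp_two (hX i) (hX j)).const_mul (q i * q j)
  simp_rw [norm_sum_smul_sq]
  rw [integral_finsetSum _ fun i _ => integrable_finsetSum _ fun j _ => hi i j]
  refine Finset.sum_congr rfl fun i _ => ?_
  rw [integral_finsetSum _ fun j _ => hi i j]
  exact Finset.sum_congr rfl fun j _ => integral_const_mul _ _

omit [IsProbabilityMeasure P] in
theorem integral_comp_of_law {μ : Measure (Fin m → Fin M)} (hS : Measurable S)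
    (hlaw : P.map S = μ) (f : (Fin m → Fin M) → ℝ) : ∫ w, f (S w) ∂P = ∫ s, f s ∂μ := by
  rw [← hlaw, integral_map hS.aemeasurable Measurable.of_discrete.aestronglyMeasurable]

variable {X : Fin M → Ω → Model d}

/-- Independence of the sample and the vectors factorises each term of the expanded square into a
moment of the weights and an entry of the expected Gram matrix. -/
theorem integral_norm_aggregate_sq (hS : Measurable S) (hX : ∀ i, MemLp (X i) 2 P)
    (hSX : IndepFun S (fun w i => X i w) P) :
    ∫ w, ‖∑ i, aggWeight (S w) i • X i w‖ ^ 2 ∂P =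
      ∑ i, ∑ j, (∫ w, aggWeight (S w) i * aggWeight (S w) j ∂P) *
        ∫ w, inner ℝ (X i w) (X j w) ∂P := by
  have hind : ∀ i j, IndepFun (fun w => aggWeight (S w) i * aggWeight (S w) j)
      (fun w => inner ℝ (X i w) (X j w)) P := fun i j =>
    hSX.comp (φ := fun s => aggWeight s i * aggWeight s j)
      (ψ := fun x : Fin M → Model d => inner ℝ (x i) (x j)) Measurable.of_discrete ((measurable_pi_apply i).inner (measurable_pi_apply j))
  have hw : ∀ i j, Integrable (fun w => aggWeight (S w) i * aggWeight (S w) j) P := by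
    intro i j
    have : Integrable (fun s : Fin m → Fin M => aggWeight s i * aggWeight s j) (P.map S) :=
      have := Measure.isProbabilityMeasure_map (μ := P) hS.aemeasurable
      (memLp_of_finite _ 1).integrable le_rfl
    exact this.comp_measurable hS
  have hi : ∀ i j, Integrable (fun w => aggWeight (S w) i * aggWeight (S w) j *
      inner ℝ (X i w) (X j w)) P := fun i j =>
    (hind i j).integrable_mul (hw i j) (integrable_inner_of_memLp_two (hX i) (hX j))
  simp_rw [norm_sum_smul_sq]
  rw [integral_finsetSum _ fun i _ => integrable_finsetSum _ fun j _ => hi i j]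
  refine Finset.sum_congr rfl fun i _ => ?_
  rw [integral_finsetSum _ fun j _ => hi i j]
  exact Finset.sum_congr rfl fun j _ => (hind i j).integral_fun_mul_eq_mul_integral
    (hw i j).1 (integrable_inner_of_memLp_two (hX i) (hX j)).1

/-- Only `E[ω_i] = p_i` and independence enter, so the first order term of the descent is the same
as with full participation. -/
theorem integral_inner_aggregate (h : IsClusteredSampling p r) (hm : 0 < m) (hS : Measurable S)
    (hlaw : P.map S = clusteredLaw r) (hX : ∀ i, MemLp (X i) 2 P)
    (hSX : IndepFun S (fun w i => X i w) P) (v : Model d) :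
    ∫ w, inner ℝ v (∑ i, aggWeight (S w) i • X i w) ∂P =
      ∫ w, inner ℝ v (∑ i, p i • X i w) ∂P := by
  have hiX : ∀ i, Integrable (fun w => inner ℝ v (X i w)) P := fun i =>
    integrable_inner_of_memLp_two (memLp_const v) (hX i)
  have hi : ∀ i, Integrable (fun w => inner ℝ v (aggWeight (S w) i • X i w)) P := fun i =>
    integrable_inner_of_memLp_two (memLp_const v) (memLp_aggWeight_smul hS (hX i) i)
  simp_rw [inner_sum]
  rw [integral_finsetSum _ fun i _ => hi i, integral_finsetSum _ fun i _ => by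
    simp_rw [real_inner_smul_right]
    exact (hiX i).const_mul _]
  refine Finset.sum_congr rfl fun i _ => ?_
  simp_rw [real_inner_smul_right]
  have hind : IndepFun (fun w => aggWeight (S w) i) (fun w => inner ℝ v (X i w)) P :=
    hSX.comp (φ := fun s => aggWeight s i) (ψ := fun x : Fin M → Model d => inner ℝ v (x i))
      Measurable.of_discrete (measurable_const.inner (measurable_pi_apply i))
  rw [hind.integral_fun_mul_eq_mul_integral
    ((Measurable.of_discrete (f := fun s : Fin m → Fin M => aggWeight s i)).comp
      hS).aestronglyMeasurable
    (hiX i).1, integral_const_mul, integral_comp_of_law hS hlaw (fun s => aggWeight s i),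
    h.integral_aggWeight hm]

-- Used with `c` the expected Gram matrix: the three sums on the right then become expected squared
-- norms, and the sign of the last one is the decisive feature.
omit [MeasurableSpace Ω] in
theorem IsClusteredSampling.sum_sum_moment_mul (h : IsClusteredSampling p r) (hm : 0 < m)
    (c : Fin M → Fin M → ℝ) :
    ∑ i, ∑ j, (p i * p j + 1 / (m : ℝ) ^ 2 *
        ∑ k, ((if i = j then r k i else 0) - r k i * r k j)) * c i j =
      ∑ i, ∑ j, p i * p j * c i j + 1 / m * ∑ i, p i * c i i -
        1 / (m : ℝ) ^ 2 * ∑ k, ∑ i, ∑ j, r k i * r k j * c i j := by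
  have hm' : (0 : ℝ) < m := by exact_mod_cast hm
  have h1 : ∀ i j, (p i * p j + 1 / (m : ℝ) ^ 2 *
      ∑ k, ((if i = j then r k i else 0) - r k i * r k j)) * c i j =
      p i * p j * c i j + (if i = j then 1 / m * (p i * c i i) else 0) -
        1 / (m : ℝ) ^ 2 * ∑ k, r k i * r k j * c i j := by
    intro i j
    rw [Finset.sum_sub_distrib, ← Finset.sum_mul]
    split_ifs with hij
    · subst hij
      rw [h.sum_clusters]
      field_simp
      ring
    · simp only [Finset.sum_const_zero]
      ring
  simp_rw [h1, Finset.sum_sub_distrib, Finset.sum_add_distrib, Finset.sum_ite_eq,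
    Finset.mem_univ, if_true, ← Finset.mul_sum]
  congr 2
  rw [Finset.sum_comm (s := Finset.univ (α := Fin m))]
  exact Finset.sum_congr rfl fun i _ => Finset.sum_comm

/-- Aggregating vectors that are independent of a clustered sample costs at most the average of
their second moments, divided by the number of sampled clients. -/
theorem integral_norm_aggregate_sq_le (h : IsClusteredSampling p r) (hm : 0 < m)
    (hS : Measurable S) (hlaw : P.map S = clusteredLaw r) (hX : ∀ i, MemLp (X i) 2 P)
    (hSX : IndepFun S (fun w i => X i w) P) :
    ∫ w, ‖∑ i, aggWeight (S w) i • X i w‖ ^ 2 ∂P ≤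
      ∫ w, ‖∑ i, p i • X i w‖ ^ 2 ∂P + 1 / m * ∑ i, p i * ∫ w, ‖X i w‖ ^ 2 ∂P := by
  have hm' : (0 : ℝ) < m := by exact_mod_cast hm
  have hdiag : ∀ i, ∫ w, inner ℝ (X i w) (X i w) ∂P = ∫ w, ‖X i w‖ ^ 2 ∂P := fun i => by
    simp_rw [real_inner_self_eq_norm_sq]
  have hmom : ∀ i j, ∫ w, aggWeight (S w) i * aggWeight (S w) j ∂P = p i * p j +
      1 / (m : ℝ) ^ 2 * ∑ k, ((if i = j then r k i else 0) - r k i * r k j) := fun i j =>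
    (integral_comp_of_law hS hlaw (fun s => aggWeight s i * aggWeight s j)).trans
      (h.integral_aggWeight_mul hm i j)
  have hr : ∑ k, ∫ w, ‖∑ i, r k i • X i w‖ ^ 2 ∂P =
      ∑ k, ∑ i, ∑ j, r k i * r k j * ∫ w, inner ℝ (X i w) (X j w) ∂P :=
    Finset.sum_congr rfl fun k _ => integral_norm_sum_smul_sq _ hX
  have key := h.sum_sum_moment_mul hm fun i j => ∫ w, inner ℝ (X i w) (X j w) ∂P
  rw [← hr, ← integral_norm_sum_smul_sq p hX] at key
  simp only [← hmom, hdiag] at key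
  rw [integral_norm_aggregate_sq hS hX hSX, key]
  -- The term subtracted in `key` is a sum of squares and can be discarded; this replaces any
  -- assumption on the signs or the shape of the covariances.
  have : 0 ≤ ∑ k, ∫ w, ‖∑ i, r k i • X i w‖ ^ 2 ∂P :=
    Finset.sum_nonneg fun k _ => integral_nonneg fun _ => by positivity
  have : 0 ≤ 1 / (m : ℝ) ^ 2 * ∑ k, ∫ w, ‖∑ i, r k i • X i w‖ ^ 2 ∂P := by positivity
  linarith

/-- Orthogonality leaves only the diagonal, where `E[ω_i²] = Var ω_i + p_i²`. This is the origin of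
`A / m` in front of the noise. -/
theorem integral_norm_aggregate_sq_of_orthogonal (h : IsClusteredSampling p r) (hm : 0 < m)
    (hS : Measurable S) (hlaw : P.map S = clusteredLaw r) (hX : ∀ i, MemLp (X i) 2 P)
    (hSX : IndepFun S (fun w i => X i w) P)
    (h0 : ∀ i j, i ≠ j → ∫ w, inner ℝ (X i w) (X j w) ∂P = 0) :
    ∫ w, ‖∑ i, aggWeight (S w) i • X i w‖ ^ 2 ∂P =
      ∑ i, (weightVar (clusteredLaw r) i + p i ^ 2) * ∫ w, ‖X i w‖ ^ 2 ∂P := by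
  rw [integral_norm_aggregate_sq hS hX hSX]
  refine Finset.sum_congr rfl fun i _ => ?_
  rw [Finset.sum_eq_single i (fun j _ hj => by rw [h0 i j hj.symm, mul_zero]) (by simp),
    integral_comp_of_law hS hlaw (fun s => aggWeight s i * aggWeight s i)]
  simp_rw [← sq, h.integral_aggWeight_sq hm, real_inner_self_eq_norm_sq]

end Aggregation

/-! ### One round from a deterministic model. -/

section Round

variable {d M m : ℕ} {Ω Ξ : Type*} [MeasurableSpace Ω] [MeasurableSpace Ξ]
  {P : Measure Ω} [IsProbabilityMeasure P]

theorem integral_inner_eq_zero_of_indepFun {X X' : Ω → Model d} (h : IndepFun X X' P)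
    (hX : Measurable X) (hX' : Measurable X') (hL : MemLp X 2 P) (hL' : MemLp X' 2 P)
    (h0 : ∫ w, X' w ∂P = 0) : ∫ w, inner ℝ (X w) (X' w) ∂P = 0 :=
  integral_inner_indepFun_eq_zero (f := fun y => y) (F := fun q : Model d × Model d => q.2) h hX
    hX' measurable_id.stronglyMeasurable hL measurable_snd.stronglyMeasurable (fun _ => hL') hL'
    fun _ => h0

/-- One round of FedAvg from the model `θ`, for the drawn clients `s` and the batches `b`. -/
def roundStep (g : Fin M → Model d → Ξ → Model d) (ηg ηl : ℝ) (K : ℕ) (θ : Model d)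
    (s : Fin m → Fin M) (b : Fin M → ℕ → Ξ) : Model d :=
  θ + ηg • ∑ i, aggWeight s i • (localSGD (g i) ηl θ (b i) K - θ)

omit [MeasurableSpace Ξ] in
theorem roundStep_sub_eq (g : Fin M → Model d → Ξ → Model d) (G : Fin M → Model d → Model d)
    (ηg ηl : ℝ) (K : ℕ) (θ : Model d) (s : Fin m → Fin M) (b : Fin M → ℕ → Ξ) :
    roundStep g ηg ηl K θ s b - θ =
      -(ηg * ηl) • (∑ i, aggWeight s i • sgdDrift (g i) (G i) ηl θ (b i) K +
        ∑ i, aggWeight s i • sgdNoise (g i) (G i) ηl θ (b i) K) := by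
  have h : ∀ i, localSGD (g i) ηl θ (b i) K - θ = _ := fun i =>
    localSGD_sub_eq (g i) (G i) ηl θ (b i) K
  simp only [roundStep, add_sub_cancel_left, h]
  rw [← Finset.sum_add_distrib, Finset.smul_sum, Finset.smul_sum]
  refine Finset.sum_congr rfl fun i _ => ?_
  module

theorem measurable_roundStep {g : Fin M → Model d → Ξ → Model d}
    (hg : ∀ i, Measurable (Function.uncurry (g i))) (ηg ηl : ℝ) (K : ℕ)
    {Ω : Type*} {mΩ : MeasurableSpace Ω} {θ : Ω → Model d} (hθ : Measurable θ)
    {s : Ω → Fin m → Fin M} (hs : Measurable s) {b : Fin M → ℕ → Ω → Ξ}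
    (hb : ∀ i k, Measurable (b i k)) :
    Measurable fun w => roundStep g ηg ηl K (θ w) (s w) (fun i k => b i k w) := by
  refine hθ.add (Measurable.const_smul (Finset.measurable_sum _ fun i _ => ?_) ηg)
  exact ((Measurable.of_discrete (f := fun s : Fin m → Fin M => aggWeight s i)).comp hs).smul
    ((measurable_localSGD (hg i) ηl hθ fun k _ => hb i k).sub hθ)

theorem measurable_sgdDrift {Ω : Type*} {mΩ : MeasurableSpace Ω} {g : Model d → Ξ → Model d}
    (hg : Measurable (Function.uncurry g)) {G : Model d → Model d} (hG : Measurable G) (ηl : ℝ)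
    (θ : Model d) {b : ℕ → Ω → Ξ} (k : ℕ) (hb : ∀ j, Measurable (b j)) :
    Measurable fun w => sgdDrift g G ηl θ (fun j => b j w) k :=
  Finset.measurable_sum _ fun _ _ =>
    hG.comp (measurable_localSGD hg ηl measurable_const fun l _ => hb l)

theorem IsUnbiasedOracle.integral_norm_drift_sub_sq_le {g : Model d → Ξ → Model d}
    {G : Model d → Model d} {ζ : ℕ → Ω → Ξ} {s L : ℝ} (h : IsUnbiasedOracle P g G ζ s)
    (hG : ∀ x y, ‖G x - G y‖ ≤ L * ‖x - y‖) (ηl : ℝ) (θ : Model d) (k : ℕ) :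
    ∫ w, ‖sgdDrift g G ηl θ (fun j => ζ j w) k - (k : ℝ) • G θ‖ ^ 2 ∂P ≤
      k * L ^ 2 * ∑ j ∈ Finset.range k,
        ∫ w, ‖localSGD g ηl θ (fun j => ζ j w) j - θ‖ ^ 2 ∂P := by
  have hi : ∀ j, Integrable (fun w => ‖localSGD g ηl θ (fun j => ζ j w) j - θ‖ ^ 2) P :=
    fun j => integrable_norm_sq_of_memLp_two (h.memLp_localSGD_sub hG ηl θ j)
  rw [← integral_finsetSum _ fun j _ => hi j, ← integral_const_mul]
  refine integral_mono (integrable_norm_sq_of_memLp_two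
    ((h.memLp_drift hG ηl θ k).sub (memLp_const _)))
    ((integrable_finsetSum _ fun j _ => hi j).const_mul _) fun w => ?_
  have h1 : sgdDrift g G ηl θ (fun j => ζ j w) k - (k : ℝ) • G θ =
      ∑ j ∈ Finset.range k, (G (localSGD g ηl θ (fun j => ζ j w) j) - G θ) := by
    rw [Finset.sum_sub_distrib, Finset.sum_const, Finset.card_range, sgdDrift, Nat.cast_smul_eq_nsmul]
  simp only
  rw [h1, mul_assoc]
  refine (norm_sum_sq_le_card_mul _ _).trans ?_
  rw [Finset.card_range, Finset.mul_sum (a := L ^ 2)]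
  gcongr with j
  rw [← mul_pow]
  exact pow_le_pow_left₀ (norm_nonneg _) (hG _ _) 2

/-- The randomness and the oracles of one round of FedAvg with clustered sampling. -/
structure IsRound (P : Measure Ω) (p : Fin M → ℝ) (r : Fin m → Fin M → ℝ)
    (g : Fin M → Model d → Ξ → Model d) (G : Fin M → Model d → Model d)
    (S : Ω → Fin m → Fin M) (ζ : Fin M → ℕ → Ω → Ξ) (s L : ℝ) : Prop where
  pos : 0 < m
  importance : IsImportance p
  sampling : IsClusteredSampling p r
  oracle : ∀ i, IsUnbiasedOracle P (g i) (G i) (ζ i) s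
  lipschitz : ∀ i x y, ‖G i x - G i y‖ ≤ L * ‖x - y‖
  indep : iIndepFun (fun q : Fin M × ℕ => ζ q.1 q.2) P
  measurable_S : Measurable S
  law_S : P.map S = clusteredLaw r
  indep_S : IndepFun S (fun w (q : Fin M × ℕ) => ζ q.1 q.2 w) P

namespace IsRound

variable {p : Fin M → ℝ} {r : Fin m → Fin M → ℝ} {g : Fin M → Model d → Ξ → Model d}
  {G : Fin M → Model d → Model d} {S : Ω → Fin m → Fin M} {ζ : Fin M → ℕ → Ω → Ξ} {s L : ℝ}

omit [IsProbabilityMeasure P] in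
theorem indepFun_S_drift (h : IsRound P p r g G S ζ s L) (ηl : ℝ) (θ : Model d) (K : ℕ) :
    IndepFun S (fun w i => sgdDrift (g i) (G i) ηl θ (fun j => ζ i j w) K) P :=
  h.indep_S.comp (φ := id)
    (ψ := fun (b : Fin M × ℕ → Ξ) i => sgdDrift (g i) (G i) ηl θ (fun j => b (i, j)) K)
    measurable_id (measurable_pi_lambda _ fun i => measurable_sgdDrift (h.oracle i).measurable_g
      (h.oracle i).measurable_G ηl θ K fun j => measurable_pi_apply (i, j))

omit [IsProbabilityMeasure P] in
theorem indepFun_S_noise (h : IsRound P p r g G S ζ s L) (ηl : ℝ) (θ : Model d) (K : ℕ) :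
    IndepFun S (fun w i => sgdNoise (g i) (G i) ηl θ (fun j => ζ i j w) K) P :=
  h.indep_S.comp (φ := id)
    (ψ := fun (b : Fin M × ℕ → Ξ) i => sgdNoise (g i) (G i) ηl θ (fun j => b (i, j)) K)
    measurable_id (measurable_pi_lambda _ fun i => measurable_sgdNoise (h.oracle i).measurable_g
      (h.oracle i).measurable_G ηl θ fun j _ => measurable_pi_apply (i, j))

-- The noises of two clients depend on disjoint blocks of batches, indexed by the client coordinate.
omit [IsProbabilityMeasure P] in
theorem indepFun_noise (h : IsRound P p r g G S ζ s L) (ηl : ℝ) (θ : Model d) (K : ℕ)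
    {i j : Fin M} (hij : i ≠ j) :
    IndepFun (fun w => sgdNoise (g i) (G i) ηl θ (fun k => ζ i k w) K)
      (fun w => sgdNoise (g j) (G j) ηl θ (fun k => ζ j k w) K) P := by
  have hi : Indep
      (⨆ q ∈ {q : Fin M × ℕ | q.1 = i}, MeasurableSpace.comap (ζ q.1 q.2) inferInstance)
      (⨆ q ∈ {q : Fin M × ℕ | q.1 = j}, MeasurableSpace.comap (ζ q.1 q.2) inferInstance) P :=
    indep_iSup_of_disjoint
      (m := fun q : Fin M × ℕ => MeasurableSpace.comap (ζ q.1 q.2) inferInstance)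
      (fun q => ((h.oracle q.1).measurable_ζ q.2).comap_le)
      ((iIndepFun_iff_iIndep _ _ _).1 h.indep)
      (Set.disjoint_left.2 fun q (hq : q.1 = i) (hq' : q.1 = j) => hij (hq.symm.trans hq'))
  have hmeas : ∀ i, Measurable[⨆ q ∈ {q : Fin M × ℕ | q.1 = i},
      MeasurableSpace.comap (ζ q.1 q.2) inferInstance]
      fun w => sgdNoise (g i) (G i) ηl θ (fun k => ζ i k w) K := fun i =>
    measurable_sgdNoise (h.oracle i).measurable_g (h.oracle i).measurable_G ηl θ fun k _ =>
      (comap_measurable (ζ i k)).mono (le_iSup₂_of_le (i, k) rfl le_rfl) le_rfl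
  rw [IndepFun_iff_Indep]
  exact indep_of_indep_of_le hi (measurable_iff_comap_le.1 (hmeas i))
    (measurable_iff_comap_le.1 (hmeas j))

theorem integral_norm_noise_sq_le (h : IsRound P p r g G S ζ s L) (ηl : ℝ) (θ : Model d)
    (K : ℕ) :
    ∫ w, ‖∑ i, aggWeight (S w) i • sgdNoise (g i) (G i) ηl θ (fun j => ζ i j w) K‖ ^ 2 ∂P ≤
      termA (clusteredLaw r) p / m * (K * s) := by
  have hm : (0 : ℝ) < m := by exact_mod_cast h.pos
  have hmeas : ∀ i, Measurable fun w => sgdNoise (g i) (G i) ηl θ (fun j => ζ i j w) K := fun i =>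
    measurable_sgdNoise (h.oracle i).measurable_g (h.oracle i).measurable_G ηl θ
      fun k _ => (h.oracle i).measurable_ζ k
  have h0 : ∀ i j, i ≠ j → ∫ w, inner ℝ (sgdNoise (g i) (G i) ηl θ (fun k => ζ i k w) K)
      (sgdNoise (g j) (G j) ηl θ (fun k => ζ j k w) K) ∂P = 0 := fun i j hij =>
    integral_inner_eq_zero_of_indepFun (h.indepFun_noise ηl θ K hij) (hmeas i) (hmeas j)
      ((h.oracle i).memLp_noise ηl θ K) ((h.oracle j).memLp_noise ηl θ K)
      ((h.oracle j).integral_noise ηl θ K)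
  have h1 := integral_norm_aggregate_sq_of_orthogonal h.sampling h.pos h.measurable_S h.law_S
    (fun i => (h.oracle i).memLp_noise ηl θ K) (h.indepFun_S_noise ηl θ K) h0
  rw [h1, termA, mul_div_cancel_left₀ _ hm.ne', Finset.sum_mul]
  gcongr with i
  · exact add_nonneg (variance_nonneg _ _) (sq_nonneg _)
  · exact (h.oracle i).integral_norm_noise_sq_le ηl θ K

/-- The weighted mean square distance of the local models from the global one. -/
def localDrift (P : Measure Ω) (p : Fin M → ℝ) (g : Fin M → Model d → Ξ → Model d)
    (ζ : Fin M → ℕ → Ω → Ξ) (ηl : ℝ) (θ : Model d) (K : ℕ) : ℝ :=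
  ∑ i, p i * ∑ k ∈ Finset.range K, ∫ w, ‖localSGD (g i) ηl θ (fun j => ζ i j w) k - θ‖ ^ 2 ∂P

theorem localDrift_le (h : IsRound P p r g G S ζ s L) {ηl : ℝ} (θ : Model d) {K : ℕ}
    (hK : 0 < K) (hsmall : 4 * (ηl * L * K) ^ 2 ≤ 1) :
    localDrift P p g ζ ηl θ K ≤
      2 * ηl ^ 2 * (K * (K - 1)) * (s + 2 * K * ∑ i, p i * ‖G i θ‖ ^ 2) := by
  calc _ ≤ ∑ i, p i * (2 * ηl ^ 2 * (K * (K - 1)) * (s + 2 * K * ‖G i θ‖ ^ 2)) := by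
        unfold localDrift
        gcongr with i
        · exact h.importance.1 i
        · exact (h.oracle i).sum_integral_norm_localSGD_sub_sq_le (h.lipschitz i) θ hK hsmall
    _ = 2 * ηl ^ 2 * (K * (K - 1)) * ((∑ i, p i) * s + 2 * K * ∑ i, p i * ‖G i θ‖ ^ 2) := by
        rw [Finset.sum_mul, Finset.mul_sum (a := 2 * (K : ℝ)), ← Finset.sum_add_distrib,
          Finset.mul_sum]
        refine Finset.sum_congr rfl fun i _ => ?_
        ring
    _ = _ := by rw [h.importance.2, one_mul]

theorem memLp_mean_drift_sub (h : IsRound P p r g G S ζ s L) (ηl : ℝ) (θ : Model d) (K : ℕ) :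
    MemLp (fun w => ∑ i, p i • (sgdDrift (g i) (G i) ηl θ (fun j => ζ i j w) K -
      (K : ℝ) • G i θ)) 2 P :=
  memLp_finsetSum _ fun i _ =>
    (((h.oracle i).memLp_drift (h.lipschitz i) ηl θ K).sub (memLp_const _)).const_smul (p i)

theorem integral_norm_mean_drift_sub_sq_le (h : IsRound P p r g G S ζ s L) (ηl : ℝ)
    (θ : Model d) (K : ℕ) :
    ∫ w, ‖∑ i, p i • (sgdDrift (g i) (G i) ηl θ (fun j => ζ i j w) K -
      (K : ℝ) • G i θ)‖ ^ 2 ∂P ≤ K * L ^ 2 * localDrift P p g ζ ηl θ K := by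
  have hi : ∀ i, Integrable (fun w => p i * ‖sgdDrift (g i) (G i) ηl θ (fun j => ζ i j w) K -
      (K : ℝ) • G i θ‖ ^ 2) P := fun i => (integrable_norm_sq_of_memLp_two
    (((h.oracle i).memLp_drift (h.lipschitz i) ηl θ K).sub (memLp_const _))).const_mul _
  calc _ ≤ ∫ w, ∑ i, p i * ‖sgdDrift (g i) (G i) ηl θ (fun j => ζ i j w) K -
        (K : ℝ) • G i θ‖ ^ 2 ∂P :=
        integral_mono (integrable_norm_sq_of_memLp_two (h.memLp_mean_drift_sub ηl θ K))
          (integrable_finsetSum _ fun i _ => hi i) fun w => norm_sum_smul_sq_le h.importance _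
    _ = ∑ i, p i * ∫ w, ‖sgdDrift (g i) (G i) ηl θ (fun j => ζ i j w) K -
        (K : ℝ) • G i θ‖ ^ 2 ∂P := by
        rw [integral_finsetSum _ fun i _ => hi i]
        simp_rw [integral_const_mul]
    _ ≤ ∑ i, p i * (K * L ^ 2 * ∑ k ∈ Finset.range K,
        ∫ w, ‖localSGD (g i) ηl θ (fun j => ζ i j w) k - θ‖ ^ 2 ∂P) := by
        gcongr with i
        · exact h.importance.1 i
        · exact (h.oracle i).integral_norm_drift_sub_sq_le (h.lipschitz i) ηl θ K
    _ = _ := by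
        rw [localDrift, Finset.mul_sum]
        refine Finset.sum_congr rfl fun i _ => ?_
        ring

omit [MeasurableSpace Ω] [MeasurableSpace Ξ] in
theorem _root_.FedSampling.mean_drift_eq (p : Fin M → ℝ) (g : Fin M → Model d → Ξ → Model d)
    (G : Fin M → Model d → Model d) (b : Fin M → ℕ → Ξ) (ηl : ℝ) (θ : Model d) (K : ℕ) :
    ∑ i, p i • sgdDrift (g i) (G i) ηl θ (b i) K =
      (K : ℝ) • ∑ i, p i • G i θ +
        ∑ i, p i • (sgdDrift (g i) (G i) ηl θ (b i) K - (K : ℝ) • G i θ) := by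
  rw [Finset.smul_sum, ← Finset.sum_add_distrib]
  refine Finset.sum_congr rfl fun i _ => ?_
  module

theorem integral_norm_mean_drift_sq_le (h : IsRound P p r g G S ζ s L) (ηl : ℝ)
    (θ : Model d) (K : ℕ) :
    ∫ w, ‖∑ i, p i • sgdDrift (g i) (G i) ηl θ (fun j => ζ i j w) K‖ ^ 2 ∂P ≤
      2 * K ^ 2 * ‖∑ i, p i • G i θ‖ ^ 2 + 2 * K * L ^ 2 * localDrift P p g ζ ηl θ K := by
  have hR := integrable_norm_sq_of_memLp_two (h.memLp_mean_drift_sub ηl θ K)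
  have hD : MemLp (fun w => ∑ i, p i • sgdDrift (g i) (G i) ηl θ (fun j => ζ i j w) K) 2 P :=
    memLp_finsetSum _ fun i _ =>
      ((h.oracle i).memLp_drift (h.lipschitz i) ηl θ K).const_smul (p i)
  have h1 := integral_mono (integrable_norm_sq_of_memLp_two hD)
    ((integrable_const (2 * (K : ℝ) ^ 2 * ‖∑ i, p i • G i θ‖ ^ 2)).add (hR.const_mul 2))
    fun w => by
      simp only [Pi.add_apply]
      rw [mean_drift_eq p g G (fun i j => ζ i j w)]
      refine (norm_add_sq_le_two_mul _ _).trans_eq ?_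
      rw [norm_smul, mul_pow, Real.norm_eq_abs, sq_abs]
      ring
  refine h1.trans ?_
  simp only [Pi.add_apply]
  rw [integral_add (integrable_const _) (hR.const_mul 2), integral_const, integral_const_mul]
  simp only [probReal_univ, one_smul]
  have := h.integral_norm_mean_drift_sub_sq_le ηl θ K
  linarith

/-- The mean drift is `K v + ρ` with `v` the global gradient and `ρ` the displacement error. Young's
inequality gives up half of `K ‖v‖²` to control `⟪v, ρ⟫`, and `E‖ρ‖² ≤ K L² V`, with `V` the local
drift, cancels the factor `1/K`. -/
theorem integral_inner_mean_drift_ge (h : IsRound P p r g G S ζ s L) (ηl : ℝ)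
    (θ : Model d) {K : ℕ} (hK : 0 < K) :
    K / 2 * ‖∑ i, p i • G i θ‖ ^ 2 - L ^ 2 / 2 * localDrift P p g ζ ηl θ K ≤
      ∫ w, inner ℝ (∑ i, p i • G i θ)
        (∑ i, p i • sgdDrift (g i) (G i) ηl θ (fun j => ζ i j w) K) ∂P := by
  have hK' : (0 : ℝ) < K := by exact_mod_cast hK
  have hR := integrable_norm_sq_of_memLp_two (h.memLp_mean_drift_sub ηl θ K)
  have hD : MemLp (fun w => ∑ i, p i • sgdDrift (g i) (G i) ηl θ (fun j => ζ i j w) K) 2 P :=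
    memLp_finsetSum _ fun i _ =>
      ((h.oracle i).memLp_drift (h.lipschitz i) ηl θ K).const_smul (p i)
  have h1 := integral_mono ((integrable_const ((K : ℝ) / 2 * ‖∑ i, p i • G i θ‖ ^ 2)).sub
    (hR.const_mul (1 / (2 * (K : ℝ)))))
    (integrable_inner_of_memLp_two (memLp_const (∑ i, p i • G i θ)) hD)
    fun w => by
      simp only [Pi.sub_apply]
      rw [mean_drift_eq p g G (fun i j => ζ i j w)]
      set v := ∑ i, p i • G i θ
      set ρ := ∑ i, p i • (sgdDrift (g i) (G i) ηl θ (fun j => ζ i j w) K - (K : ℝ) • G i θ)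
      rw [inner_add_right, real_inner_smul_right, real_inner_self_eq_norm_sq]
      -- Dividing this square by `2 K` gives exactly the required form of Young's inequality.
      have h2 : 0 ≤ ‖(K : ℝ) • v + ρ‖ ^ 2 := sq_nonneg _
      rw [norm_add_sq_real, real_inner_smul_left, norm_smul, mul_pow, Real.norm_eq_abs,
        sq_abs] at h2
      have h3 : 0 ≤ 1 / (2 * (K : ℝ)) * ((K : ℝ) ^ 2 * ‖v‖ ^ 2 + 2 * (K * inner ℝ v ρ) +
        ‖ρ‖ ^ 2) := by positivity
      have h4 : 1 / (2 * (K : ℝ)) * ((K : ℝ) ^ 2 * ‖v‖ ^ 2 + 2 * (K * inner ℝ v ρ) +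
        ‖ρ‖ ^ 2) = K / 2 * ‖v‖ ^ 2 + inner ℝ v ρ + 1 / (2 * (K : ℝ)) * ‖ρ‖ ^ 2 := by
        field_simp
      linarith
  refine le_trans ?_ h1
  simp only [Pi.sub_apply]
  rw [integral_sub (integrable_const _) (hR.const_mul _), integral_const, integral_const_mul]
  simp only [probReal_univ, one_smul]
  have h5 := mul_le_mul_of_nonneg_left (h.integral_norm_mean_drift_sub_sq_le ηl θ K)
    (by positivity : 0 ≤ 1 / (2 * (K : ℝ)))
  have h6 : 1 / (2 * (K : ℝ)) * (K * L ^ 2 * localDrift P p g ζ ηl θ K) =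
    L ^ 2 / 2 * localDrift P p g ζ ηl θ K := by field_simp
  linarith

theorem integral_norm_drift_sq_le (h : IsRound P p r g G S ζ s L) (ηl : ℝ) (θ : Model d)
    (K : ℕ) :
    ∫ w, ‖∑ i, aggWeight (S w) i • sgdDrift (g i) (G i) ηl θ (fun j => ζ i j w) K‖ ^ 2 ∂P ≤
      2 * K ^ 2 * ‖∑ i, p i • G i θ‖ ^ 2 + 4 * K * L ^ 2 * localDrift P p g ζ ηl θ K +
        2 * (K ^ 2 / m) * ∑ i, p i * ‖G i θ‖ ^ 2 := by
  have hm : (1 : ℝ) ≤ m := by exact_mod_cast h.pos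
  have hV : 0 ≤ localDrift P p g ζ ηl θ K := Finset.sum_nonneg fun i _ =>
    mul_nonneg (h.importance.1 i) (Finset.sum_nonneg fun k _ => integral_nonneg fun _ => by positivity)
  have h1 := integral_norm_aggregate_sq_le h.sampling h.pos h.measurable_S h.law_S
    (X := fun i w => sgdDrift (g i) (G i) ηl θ (fun j => ζ i j w) K)
    (fun i => (h.oracle i).memLp_drift (h.lipschitz i) ηl θ K) (h.indepFun_S_drift ηl θ K)
  have h2 : ∑ i, p i * ∫ w, ‖sgdDrift (g i) (G i) ηl θ (fun j => ζ i j w) K‖ ^ 2 ∂P ≤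
      2 * K * L ^ 2 * localDrift P p g ζ ηl θ K + 2 * K ^ 2 * ∑ i, p i * ‖G i θ‖ ^ 2 := by
    rw [localDrift, Finset.mul_sum, Finset.mul_sum, ← Finset.sum_add_distrib]
    refine Finset.sum_le_sum fun i _ => ?_
    refine (mul_le_mul_of_nonneg_left ((h.oracle i).integral_norm_drift_sq_le (h.lipschitz i) ηl θ K)
      (h.importance.1 i)).trans_eq ?_
    rw [Finset.sum_add_distrib, ← Finset.mul_sum, Finset.sum_const, Finset.card_range,
      nsmul_eq_mul]
    ring
  have h3 := mul_le_mul_of_nonneg_left h2 (by positivity : 0 ≤ 1 / (m : ℝ))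
  -- The factor `1/m` is wasted on the displacement, but kept on the client gradients in `h5`, where
  -- it becomes `F = K/m`.
  have h4 : 1 / (m : ℝ) * (2 * K * L ^ 2 * localDrift P p g ζ ηl θ K) ≤
      2 * K * L ^ 2 * localDrift P p g ζ ηl θ K :=
    mul_le_of_le_one_left (by positivity) (by rw [div_le_one (by positivity)]; exact hm)
  have h5 : 1 / (m : ℝ) * (2 * K ^ 2 * ∑ i, p i * ‖G i θ‖ ^ 2) =
    2 * (K ^ 2 / m) * ∑ i, p i * ‖G i θ‖ ^ 2 := by ring
  rw [mul_add] at h3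
  linarith [h.integral_norm_mean_drift_sq_le ηl θ K]

end IsRound

end Round

/-! ### Expected descent in one round. -/

/-- Here `t = η_g η_l`, `η = η_l`, `γ` is the squared global gradient, `V` the local drift, `W` the
weighted mean of the squared client gradients, and `A` stands for `A / m`. In units of `t K γ` the
gradient coefficient is at most `-1/2 + 4/32 + 4/32 + (3/4)/256`, which is below `-1/8`. The factor
4 on the errors is dictated by the `κ²` part of the `W` term. -/
theorem descent_arithmetic {K : ℕ} (hK : 0 < K) {m : ℕ} (hm : 0 < m)
    {t η L s γ V W A β κ : ℝ} (ht : 0 < t) (hη : 0 < η) (hL : 0 ≤ L) (hβ : 1 ≤ β)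
    (hs : 0 ≤ s) (hγ : 0 ≤ γ) (hV0 : 0 ≤ V) (hA : 0 ≤ A)
    (hV : V ≤ 2 * η ^ 2 * (K * (K - 1)) * (s + 2 * K * W)) (hW : W ≤ β ^ 2 * γ + κ ^ 2)
    (ha : t * L * K * β ^ 2 ≤ 1 / 32) (hb : η * L * K * β ^ 2 ≤ 1 / 32) :
    -t * (K / 2 * γ - L ^ 2 / 2 * V) + L * t ^ 2 *
        (2 * (2 * K ^ 2 * γ + 4 * K * L ^ 2 * V + 2 * (K ^ 2 / m) * W) + 2 * (A * (K * s))) ≤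
      -(t * K / 8) * γ + t * K * (4 * (L * t * A * s + L ^ 2 * η ^ 2 * (K - 1) * s +
        L ^ 2 * η ^ 2 * (K * (K - 1)) * κ ^ 2 + L * t * (K / m) * κ ^ 2)) := by
  have hK1 : (1 : ℝ) ≤ K := by exact_mod_cast hK
  have hK1' : (0 : ℝ) ≤ K - 1 := by linarith
  have hm1 : (1 : ℝ) ≤ m := by exact_mod_cast hm
  have hβ2 : 1 ≤ β ^ 2 := one_le_pow₀ hβ
  have ha0 : 0 ≤ t * L * K := by positivity
  have hb0 : 0 ≤ η * L * K := by positivity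
  have ha' : t * L * K ≤ 1 / 32 := (le_mul_of_one_le_right ha0 hβ2).trans ha
  have hb' : η * L * K ≤ 1 / 32 := (le_mul_of_one_le_right hb0 hβ2).trans hb
  -- the terms that contain `V`
  have h1 : (t * L * K) * (t * L ^ 2 * V) ≤ 1 / 32 * (t * L ^ 2 * V) := by gcongr
  have h2 : t * L ^ 2 * V ≤ t * L ^ 2 * (2 * η ^ 2 * (K * (K - 1)) *
      (s + 2 * K * (β ^ 2 * γ + κ ^ 2))) := by
    refine mul_le_mul_of_nonneg_left (hV.trans ?_) (by positivity)
    gcongr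
  have h3 : (η * L * K) * (η * L * K * β ^ 2) ≤ 1 / 32 * (1 / 32) := by gcongr
  have h4 : t * L ^ 2 * (2 * η ^ 2 * (K * (K - 1)) * (2 * K * (β ^ 2 * γ))) ≤
      t * K * γ * (1 / 256) := by
    calc _ = 4 * (t * γ * (η ^ 2 * L ^ 2 * K ^ 2 * β ^ 2)) * (K - 1) := by ring
      _ ≤ 4 * (t * γ * (η ^ 2 * L ^ 2 * K ^ 2 * β ^ 2)) * K := by gcongr; linarith
      _ = 4 * (t * K * γ) * ((η * L * K) * (η * L * K * β ^ 2)) := by ring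
      _ ≤ 4 * (t * K * γ) * (1 / 32 * (1 / 32)) := by gcongr
      _ = _ := by ring
  -- the terms that contain `γ` and `W`
  have h5 : (t * L * K) * (t * K * γ) ≤ 1 / 32 * (t * K * γ) := by gcongr
  have h6 : L * t ^ 2 * (K ^ 2 / m) * W ≤ L * t ^ 2 * (K ^ 2 / m) * (β ^ 2 * γ + κ ^ 2) := by
    gcongr
  have h7 : L * t ^ 2 * (K ^ 2 / m) * (β ^ 2 * γ) ≤ 1 / 32 * (t * K * γ) := by
    calc _ ≤ L * t ^ 2 * (K ^ 2) * (β ^ 2 * γ) := by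
          gcongr
          exact div_le_self (by positivity) hm1
      _ = (t * L * K * β ^ 2) * (t * K * γ) := by ring
      _ ≤ _ := by gcongr
  have hp : 0 ≤ t * K * γ := by positivity
  have q1 : 0 ≤ t * K * (L * t * A * s) := by positivity
  have q2 : 0 ≤ t * K * (L ^ 2 * η ^ 2 * (K - 1) * s) := by positivity
  have q3 : 0 ≤ t * K * (L ^ 2 * η ^ 2 * (K * (K - 1)) * κ ^ 2) := by positivity
  have q4 : 0 ≤ t * K * (L * t * (K / m) * κ ^ 2) := by positivity
  have e4 : L * t ^ 2 * (K ^ 2 / m) * κ ^ 2 = t * K * (L * t * (K / m) * κ ^ 2) := by ring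
  have e2 : t * L ^ 2 * (2 * η ^ 2 * (K * (K - 1)) * (s + 2 * K * (β ^ 2 * γ + κ ^ 2))) =
      2 * (t * K * (L ^ 2 * η ^ 2 * (K - 1) * s)) +
      t * L ^ 2 * (2 * η ^ 2 * (K * (K - 1)) * (2 * K * (β ^ 2 * γ))) +
      4 * (t * K * (L ^ 2 * η ^ 2 * (K * (K - 1)) * κ ^ 2)) := by ring
  have e0 : -t * (K / 2 * γ - L ^ 2 / 2 * V) + L * t ^ 2 *
        (2 * (2 * K ^ 2 * γ + 4 * K * L ^ 2 * V + 2 * (K ^ 2 / m) * W) + 2 * (A * (K * s))) =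
      -(t * K * γ) / 2 + t * L ^ 2 * V / 2 + 4 * ((t * L * K) * (t * K * γ)) +
      8 * ((t * L * K) * (t * L ^ 2 * V)) + 4 * (L * t ^ 2 * (K ^ 2 / m) * W) +
      2 * (t * K * (L * t * A * s)) := by ring
  rw [e0]
  rw [mul_add, e4] at h6
  rw [e2] at h2
  have e5 : -(t * K / 8) * γ + t * K * (4 * (L * t * A * s + L ^ 2 * η ^ 2 * (K - 1) * s +
        L ^ 2 * η ^ 2 * (K * (K - 1)) * κ ^ 2 + L * t * (K / m) * κ ^ 2)) =
      -(t * K * γ) / 8 + 4 * (t * K * (L * t * A * s)) +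
      4 * (t * K * (L ^ 2 * η ^ 2 * (K - 1) * s)) +
      4 * (t * K * (L ^ 2 * η ^ 2 * (K * (K - 1)) * κ ^ 2)) +
      4 * (t * K * (L * t * (K / m) * κ ^ 2)) := by ring
  rw [e5]
  linarith

section Round

variable {d M m : ℕ} {Ω Ξ : Type*} [MeasurableSpace Ω] [MeasurableSpace Ξ]
  {P : Measure Ω} [IsProbabilityMeasure P]
  {p : Fin M → ℝ} {r : Fin m → Fin M → ℝ} {g : Fin M → Model d → Ξ → Model d}
  {G : Fin M → Model d → Model d} {S : Ω → Fin m → Fin M} {ζ : Fin M → ℕ → Ω → Ξ} {s L : ℝ}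

/-- The smoothness inequality `hdesc` is two-sided because the lower half is needed as well: it
makes `f` after the round integrable. -/
theorem IsRound.expected_descent (h : IsRound P p r g G S ζ s L) {f : Model d → ℝ}
    (hf : Measurable f) {θ : Model d}
    (hdesc : ∀ y, |f y - f θ - inner ℝ (∑ i, p i • G i θ) (y - θ)| ≤ L * ‖y - θ‖ ^ 2)
    {β κ ηg ηl : ℝ} {K : ℕ} (hK : 0 < K) (hL : 0 ≤ L) (hβ : 1 ≤ β) (hηg : 0 < ηg) (hηl : 0 < ηl)
    (hdis : ∑ i, p i * ‖G i θ‖ ^ 2 ≤ β ^ 2 * ‖∑ i, p i • G i θ‖ ^ 2 + κ ^ 2)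
    (hc : ηl * ((1 + ηg) * β ^ 2 * L * K) ≤ 1 / 32) :
    Integrable (fun w => f (roundStep g ηg ηl K θ (S w) (fun i k => ζ i k w))) P ∧
      ∫ w, f (roundStep g ηg ηl K θ (S w) (fun i k => ζ i k w)) ∂P ≤
        f θ - (ηg * ηl * K / 8) * ‖∑ i, p i • G i θ‖ ^ 2 +
        ηg * ηl * K * (4 * (L * (ηg * ηl) * (termA (clusteredLaw r) p / m) * s +
          L ^ 2 * ηl ^ 2 * (K - 1) * s + L ^ 2 * ηl ^ 2 * (K * (K - 1)) * κ ^ 2 +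
          L * (ηg * ηl) * (K / m) * κ ^ 2)) := by
  set v := ∑ i, p i • G i θ with hv
  set D : Ω → Model d := fun w => ∑ i, aggWeight (S w) i •
    sgdDrift (g i) (G i) ηl θ (fun j => ζ i j w) K with hD
  set N : Ω → Model d := fun w => ∑ i, aggWeight (S w) i •
    sgdNoise (g i) (G i) ηl θ (fun j => ζ i j w) K with hN
  set X : Ω → Model d := fun w => roundStep g ηg ηl K θ (S w) (fun i k => ζ i k w) with hX
  have hXm : Measurable X := measurable_roundStep (fun i => (h.oracle i).measurable_g) ηg ηl K
    measurable_const h.measurable_S fun i k => (h.oracle i).measurable_ζ k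
  have hLD : MemLp D 2 P := memLp_finsetSum _ fun i _ => memLp_aggWeight_smul h.measurable_S
    ((h.oracle i).memLp_drift (h.lipschitz i) ηl θ K) i
  have hLN : MemLp N 2 P := memLp_finsetSum _ fun i _ => memLp_aggWeight_smul h.measurable_S
    ((h.oracle i).memLp_noise ηl θ K) i
  have hXD : ∀ w, X w - θ = -(ηg * ηl) • (D w + N w) := fun w => roundStep_sub_eq g G ηg ηl K θ _ _
  have hvD : Integrable (fun w => inner ℝ v (D w)) P :=
    integrable_inner_of_memLp_two (memLp_const v) hLD
  have hvN : Integrable (fun w => inner ℝ v (N w)) P :=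
    integrable_inner_of_memLp_two (memLp_const v) hLN
  have hD2 := integrable_norm_sq_of_memLp_two hLD
  have hN2 := integrable_norm_sq_of_memLp_two hLN
  -- pointwise bounds
  have hsq : ∀ w, ‖X w - θ‖ ^ 2 ≤ (ηg * ηl) ^ 2 * (2 * ‖D w‖ ^ 2 + 2 * ‖N w‖ ^ 2) := fun w => by
    rw [hXD, norm_smul, mul_pow, norm_neg, Real.norm_eq_abs, sq_abs]
    gcongr
    exact norm_add_sq_le_two_mul _ _
  have hin : ∀ w, inner ℝ v (X w - θ) = -(ηg * ηl) * (inner ℝ v (D w) + inner ℝ v (N w)) :=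
    fun w => by rw [hXD, real_inner_smul_right, inner_add_right]
  have hbound : ∀ w, |f (X w) - f θ + ηg * ηl * (inner ℝ v (D w) + inner ℝ v (N w))| ≤
      L * ((ηg * ηl) ^ 2 * (2 * ‖D w‖ ^ 2 + 2 * ‖N w‖ ^ 2)) := fun w => by
    have h1 := hdesc (X w)
    rw [hin, neg_mul, sub_neg_eq_add] at h1
    exact h1.trans (mul_le_mul_of_nonneg_left (hsq w) hL)
  have hquad : Integrable (fun w => L * ((ηg * ηl) ^ 2 * (2 * ‖D w‖ ^ 2 + 2 * ‖N w‖ ^ 2))) P :=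
    (((hD2.const_mul 2).add (hN2.const_mul 2)).const_mul _).const_mul L
  have hlin : Integrable (fun w => f θ - ηg * ηl * (inner ℝ v (D w) + inner ℝ v (N w))) P :=
    (integrable_const _).sub ((hvD.add hvN).const_mul _)
  have hfX : Integrable (fun w => f (X w)) P := by
    have h1 : Integrable
        (fun w => f (X w) - f θ + ηg * ηl * (inner ℝ v (D w) + inner ℝ v (N w))) P := by
      refine hquad.mono' ?_ (Filter.Eventually.of_forall hbound)
      exact ((hf.comp hXm).aestronglyMeasurable.sub aestronglyMeasurable_const).add
        ((hvD.add hvN).const_mul _).1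
    refine (h1.add hlin).congr (Filter.Eventually.of_forall fun w => ?_)
    simp only [Pi.add_apply]
    ring
  refine ⟨hfX, ?_⟩
  have hmono : ∫ w, f (X w) ∂P ≤ f θ - ηg * ηl * (∫ w, inner ℝ v (D w) ∂P +
      ∫ w, inner ℝ v (N w) ∂P) +
      L * ((ηg * ηl) ^ 2 * (2 * ∫ w, ‖D w‖ ^ 2 ∂P + 2 * ∫ w, ‖N w‖ ^ 2 ∂P)) := by
    have h1 := integral_mono hfX (hlin.add hquad) fun w => by
      have := (abs_le.1 (hbound w)).2
      simp only [Pi.add_apply]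
      linarith
    refine h1.trans_eq ?_
    have h2 : ∫ w, (inner ℝ v (D w) + inner ℝ v (N w)) ∂P =
        ∫ w, inner ℝ v (D w) ∂P + ∫ w, inner ℝ v (N w) ∂P := integral_add hvD hvN
    have h3 : ∫ w, (f θ - ηg * ηl * (inner ℝ v (D w) + inner ℝ v (N w))) ∂P =
        f θ - ηg * ηl * (∫ w, inner ℝ v (D w) ∂P + ∫ w, inner ℝ v (N w) ∂P) := by
      have hsum : Integrable (fun w => inner ℝ v (D w) + inner ℝ v (N w)) P := hvD.add hvN
      rw [integral_sub (integrable_const _) (hsum.const_mul (ηg * ηl)), integral_const_mul, h2]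
      simp
    rw [integral_add' hlin hquad, h3, integral_const_mul, integral_const_mul,
      integral_add (hD2.const_mul 2) (hN2.const_mul 2), integral_const_mul, integral_const_mul]
  have hN0 : ∫ w, inner ℝ v (N w) ∂P = 0 := by
    have hL' : ∀ i, MemLp (fun w => sgdNoise (g i) (G i) ηl θ (fun j => ζ i j w) K) 2 P :=
      fun i => (h.oracle i).memLp_noise ηl θ K
    rw [hN, integral_inner_aggregate h.sampling h.pos h.measurable_S h.law_S hL'
      (h.indepFun_S_noise ηl θ K) v]
    have hi : ∀ i, Integrable
        (fun w => p i • sgdNoise (g i) (G i) ηl θ (fun j => ζ i j w) K) P :=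
      fun i => ((hL' i).integrable one_le_two).smul (p i)
    rw [integral_inner (integrable_finsetSum _ fun i _ => hi i),
      integral_finsetSum _ fun i _ => hi i]
    simp_rw [integral_smul, (h.oracle _).integral_noise]
    simp
  have hDv := h.integral_inner_mean_drift_ge ηl θ hK
  rw [← integral_inner_aggregate h.sampling h.pos h.measurable_S h.law_S
    (fun i => (h.oracle i).memLp_drift (h.lipschitz i) ηl θ K) (h.indepFun_S_drift ηl θ K)] at hDv
  have hDD := h.integral_norm_drift_sq_le ηl θ K
  have hNN := h.integral_norm_noise_sq_le ηl θ K
  -- Importances summing to one force at least one client, and its variance bound shows `0 ≤ s`.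
  have hM : ∃ i : Fin M, True := by
    by_contra hcon
    have : IsEmpty (Fin M) := ⟨fun i => hcon ⟨i, trivial⟩⟩
    simpa using h.importance.2
  obtain ⟨i₀, -⟩ := hM
  have hs : 0 ≤ s := (integral_nonneg fun _ => by positivity).trans ((h.oracle i₀).var 0 0)
  have hβ2 : 1 ≤ β ^ 2 := one_le_pow₀ hβ
  -- The factor `1 + ηg` encodes two smallness conditions at once, on the global step `ηg * ηl` and
  -- on the local step `ηl`.
  have hab : ηg * ηl * L * K * β ^ 2 + ηl * L * K * β ^ 2 ≤ 1 / 32 := by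
    refine le_trans (le_of_eq ?_) hc
    ring
  have ha0 : 0 ≤ ηg * ηl * L * K * β ^ 2 := by positivity
  have hb0 : 0 ≤ ηl * L * K * β ^ 2 := by positivity
  have hb1 : ηl * L * K ≤ 1 / 32 :=
    (le_mul_of_one_le_right (by positivity) hβ2).trans (by linarith)
  have hsmall : 4 * (ηl * L * K) ^ 2 ≤ 1 := by
    have : (ηl * L * K) ^ 2 ≤ (1 / 32) ^ 2 := by gcongr
    linarith
  have hm : (0 : ℝ) < m := by exact_mod_cast h.pos
  have hA : 0 ≤ termA (clusteredLaw r) p / m := by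
    refine div_nonneg (mul_nonneg hm.le (Finset.sum_nonneg fun i _ => ?_)) hm.le
    exact add_nonneg (variance_nonneg _ _) (sq_nonneg _)
  have hV0 : 0 ≤ IsRound.localDrift P p g ζ ηl θ K := Finset.sum_nonneg fun i _ =>
    mul_nonneg (h.importance.1 i)
      (Finset.sum_nonneg fun k _ => integral_nonneg fun _ => by positivity)
  have harith := descent_arithmetic hK h.pos (t := ηg * ηl) (mul_pos hηg hηl) hηl hL hβ hs
    (sq_nonneg ‖v‖) hV0 hA (h.localDrift_le θ hK hsmall) hdis (by linarith) (by linarith)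
  have h1 : ηg * ηl * (K / 2 * ‖v‖ ^ 2 - L ^ 2 / 2 * IsRound.localDrift P p g ζ ηl θ K) ≤
      ηg * ηl * ∫ w, inner ℝ v (D w) ∂P := by gcongr
  have h2 : L * ((ηg * ηl) ^ 2 * (2 * ∫ w, ‖D w‖ ^ 2 ∂P + 2 * ∫ w, ‖N w‖ ^ 2 ∂P)) ≤
      L * ((ηg * ηl) ^ 2 * (2 * (2 * K ^ 2 * ‖v‖ ^ 2 +
        4 * K * L ^ 2 * IsRound.localDrift P p g ζ ηl θ K +
        2 * (K ^ 2 / m) * ∑ i, p i * ‖G i θ‖ ^ 2) +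
        2 * (termA (clusteredLaw r) p / m * (K * s)))) := by gcongr
  rw [hN0, add_zero] at hmono
  rw [← mul_assoc L, ← mul_assoc L] at h2
  rw [← mul_assoc L] at hmono
  linarith

end Round

/-! ### Smoothness of the global objective. -/

section Loss

variable {d M : ℕ} {p : Fin M → ℝ} {loss : Fin M → Model d → ℝ} {L : ℝ}

theorem Smooth.hasGradientAt_globalLoss (h : Smooth loss L) (p : Fin M → ℝ) (x : Model d) :
    HasGradientAt (globalLoss p loss) (∑ i, p i • gradient (loss i) x) x := by
  rw [hasGradientAt_iff_hasFDerivAt, map_sum]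
  simp_rw [map_smul]
  refine HasFDerivAt.fun_sum fun i _ => ?_
  exact ((h i).1 x).hasGradientAt.hasFDerivAt.const_mul (p i)

theorem Smooth.gradient_globalLoss (h : Smooth loss L) (p : Fin M → ℝ) (x : Model d) :
    gradient (globalLoss p loss) x = ∑ i, p i • gradient (loss i) x :=
  (h.hasGradientAt_globalLoss p x).gradient

theorem Smooth.norm_gradient_globalLoss_sub_le (h : Smooth loss L) (hp : IsImportance p)
    (x y : Model d) :
    ‖∑ i, p i • gradient (loss i) x - ∑ i, p i • gradient (loss i) y‖ ≤ L * ‖x - y‖ := by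
  rw [← Finset.sum_sub_distrib]
  calc _ ≤ ∑ i, ‖p i • gradient (loss i) x - p i • gradient (loss i) y‖ := norm_sum_le _ _
    _ ≤ ∑ i, p i * (L * ‖x - y‖) := by
        refine Finset.sum_le_sum fun i _ => ?_
        rw [← smul_sub, norm_smul, Real.norm_of_nonneg (hp.1 i)]
        exact mul_le_mul_of_nonneg_left ((h i).2 x y) (hp.1 i)
    _ = _ := by rw [← Finset.sum_mul, hp.2, one_mul]

/-- Mean value inequality on the segment for `f` minus its linearisation at `x`. It gives `L` in
place of the sharp `L / 2`, which only affects absolute constants. -/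
theorem Smooth.abs_globalLoss_sub_le (h : Smooth loss L) (hL : 0 ≤ L) (hp : IsImportance p)
    (x y : Model d) :
    |globalLoss p loss y - globalLoss p loss x -
      inner ℝ (∑ i, p i • gradient (loss i) x) (y - x)| ≤ L * ‖y - x‖ ^ 2 := by
  have h1 := (convex_segment (𝕜 := ℝ) x y).norm_image_sub_le_of_norm_hasFDerivWithin_le'
    (f := globalLoss p loss) (φ := InnerProductSpace.toDual ℝ _ (∑ i, p i • gradient (loss i) x))
    (C := L * ‖y - x‖)
    (fun z _ => (h.hasGradientAt_globalLoss p z).hasFDerivAt.hasFDerivWithinAt) (fun z hz => by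
      rw [← map_sub, LinearIsometryEquiv.norm_map]
      refine (h.norm_gradient_globalLoss_sub_le hp z x).trans ?_
      exact mul_le_mul_of_nonneg_left (norm_sub_le_of_mem_segment hz) hL)
    (left_mem_segment ℝ x y) (right_mem_segment ℝ x y)
  rw [InnerProductSpace.toDual_apply_apply, Real.norm_eq_abs] at h1
  refine h1.trans_eq ?_
  ring

theorem measurable_of_lipschitz {G : Model d → Model d} (hL : 0 ≤ L)
    (hG : ∀ x y, ‖G x - G y‖ ≤ L * ‖x - y‖) : Measurable G := by
  refine (LipschitzWith.of_dist_le_mul (K := ⟨L, hL⟩) fun x y => ?_).continuous.measurable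
  rw [dist_eq_norm, dist_eq_norm]
  exact hG x y

end Loss

/-! ### Independence of the current model and the next round. -/

section Independence

variable {Ω ι κ : Type*} [MeasurableSpace Ω] {P : Measure Ω}

/-- Two mutually independent families that are independent of each other form one mutually
independent family. -/
theorem iIndep_sum {m₁ : ι → MeasurableSpace Ω} {m₂ : κ → MeasurableSpace Ω}
    (h₁ : iIndep m₁ P) (h₂ : iIndep m₂ P) (h : Indep (⨆ i, m₁ i) (⨆ j, m₂ j) P) :
    iIndep (Sum.elim m₁ m₂) P := by
  rw [iIndep_iff]
  intro s f hf
  have hl : ∀ i ∈ s.toLeft, MeasurableSet[m₁ i] (f (Sum.inl i)) := fun i hi =>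
    hf _ (Finset.mem_toLeft.1 hi)
  have hr : ∀ j ∈ s.toRight, MeasurableSet[m₂ j] (f (Sum.inr j)) := fun j hj =>
    hf _ (Finset.mem_toRight.1 hj)
  have hs : (⋂ i ∈ s, f i) =
      (⋂ i ∈ s.toLeft, f (Sum.inl i)) ∩ ⋂ j ∈ s.toRight, f (Sum.inr j) := by
    ext w
    simp only [Set.mem_iInter, Set.mem_inter_iff, Finset.mem_toLeft, Finset.mem_toRight,
      Sum.forall]
  rw [hs, (Indep_iff _ _ _).1 h _ _
    (Finset.measurableSet_biInter _ fun i hi => le_iSup m₁ i _ (hl i hi))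
    (Finset.measurableSet_biInter _ fun j hj => le_iSup m₂ j _ (hr j hj)),
    h₁.meas_biInter hl, h₂.meas_biInter hr]
  conv_rhs => rw [← Finset.toLeft_disjSum_toRight (u := s), Finset.prod_disjSum]

end Independence

section Run

variable {d M m : ℕ} {Ω Ξ : Type*} [MeasurableSpace Ω] [MeasurableSpace Ξ]
  {P : Measure Ω} {g : Fin M → Model d → Ξ → Model d}
  {S : ℕ → Ω → Fin m → Fin M} {ξ : ℕ → Fin M → ℕ → Ω → Ξ}

theorem measurable_fedAvg {Ω : Type*} {mΩ : MeasurableSpace Ω}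
    (hg : ∀ i, Measurable (Function.uncurry (g i))) (ηg ηl : ℝ) (K : ℕ) (θ₀ : Model d)
    {S : ℕ → Ω → Fin m → Fin M} {ξ : ℕ → Fin M → ℕ → Ω → Ξ} {t : ℕ}
    (hS : ∀ u < t, Measurable (S u)) (hξ : ∀ u < t, ∀ i k, Measurable (ξ u i k)) :
    Measurable fun w => fedAvg g ηg ηl K θ₀ (fun t => S t w) (fun t i k => ξ t i k w) t := by
  induction t with
  | zero => exact measurable_const
  | succ t ih =>
    exact measurable_roundStep hg ηg ηl K
      (ih (fun u hu => hS u (hu.trans t.lt_succ_self)) fun u hu => hξ u (hu.trans t.lt_succ_self))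
      (hS t t.lt_succ_self) (hξ t t.lt_succ_self)

theorem measurable_sample_batches {Ω : Type*} {mΩ : MeasurableSpace Ω} {s : Ω → Fin m → Fin M}
    {b : Fin M → ℕ → Ω → Ξ} (hs : Measurable s) (hb : ∀ i k, Measurable (b i k)) :
    Measurable fun w => (s w, fun q : Fin M × ℕ => b q.1 q.2 w) :=
  hs.prodMk (measurable_pi_lambda _ fun q => hb q.1 q.2)

/-- All samples and batches form one independent family over a sum type, graded by the round. The
model uses the indices of rounds before `t`, the next step those of round `t`, and these index sets
are disjoint. -/
theorem IsRunRandomness.indepFun_fedAvg {μ : Measure (Fin m → Fin M)}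
    (h : IsRunRandomness P μ S ξ) (hg : ∀ i, Measurable (Function.uncurry (g i)))
    (ηg ηl : ℝ) (K : ℕ) (θ₀ : Model d) (t : ℕ) :
    IndepFun (fun w => fedAvg g ηg ηl K θ₀ (fun t => S t w) (fun t i k => ξ t i k w) t)
      (fun w => (S t w, fun q : Fin M × ℕ => ξ t q.1 q.2 w)) P := by
  set mS : ℕ → MeasurableSpace Ω := fun t => MeasurableSpace.comap (S t) inferInstance with hmS
  set mξ : ℕ × Fin M × ℕ → MeasurableSpace Ω := fun q =>
    MeasurableSpace.comap (ξ q.1 q.2.1 q.2.2) inferInstance with hmξ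
  have hsum : iIndep (Sum.elim mS mξ) P := by
    refine iIndep_sum ((iIndepFun_iff_iIndep _ _ _).1 h.indep_S)
      ((iIndepFun_iff_iIndep _ _ _).1 h.indep_ξ) ?_
    refine indep_of_indep_of_le ((IndepFun_iff_Indep _ _ _).1 h.indep_S_ξ) ?_ ?_
    · refine iSup_le fun t => measurable_iff_comap_le.1 ?_
      exact (measurable_pi_apply t).comp
        (comap_measurable (m := MeasurableSpace.pi) fun w (t : ℕ) => S t w)
    · refine iSup_le fun q => measurable_iff_comap_le.1 ?_
      exact (measurable_pi_apply q).comp (comap_measurable (m := MeasurableSpace.pi)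
        fun w (q : ℕ × Fin M × ℕ) => ξ q.1 q.2.1 q.2.2 w)
  have hle : ∀ q, Sum.elim mS mξ q ≤ ‹MeasurableSpace Ω› := by
    rintro (u | q)
    · exact (h.measurable_S u).comap_le
    · exact (h.measurable_ξ q.1 q.2.1 q.2.2).comap_le
  let round : ℕ ⊕ (ℕ × Fin M × ℕ) → ℕ := Sum.elim id Prod.fst
  have hind : Indep (⨆ q ∈ {q | round q < t}, Sum.elim mS mξ q)
      (⨆ q ∈ {q | round q = t}, Sum.elim mS mξ q) P :=
    indep_iSup_of_disjoint (m := Sum.elim mS mξ) hle hsum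
      (Set.disjoint_left.2 fun q (hq : round q < t) (hq' : round q = t) => hq.ne hq')
  have hmS : ∀ (A : Set (ℕ ⊕ (ℕ × Fin M × ℕ))) u, Sum.inl u ∈ A →
      Measurable[⨆ q ∈ A, Sum.elim mS mξ q] (S u) := fun A u hu =>
    (comap_measurable (S u)).mono (le_iSup₂_of_le (f := fun q (_ : q ∈ A) => Sum.elim mS mξ q)
      (Sum.inl u) hu le_rfl) le_rfl
  have hmξ : ∀ (A : Set (ℕ ⊕ (ℕ × Fin M × ℕ))) u i k, Sum.inr (u, i, k) ∈ A →
      Measurable[⨆ q ∈ A, Sum.elim mS mξ q] (ξ u i k) := fun A u i k hu =>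
    (comap_measurable (ξ u i k)).mono (le_iSup₂_of_le
      (f := fun q (_ : q ∈ A) => Sum.elim mS mξ q) (Sum.inr (u, i, k)) hu le_rfl) le_rfl
  rw [IndepFun_iff_Indep]
  refine indep_of_indep_of_le hind (measurable_iff_comap_le.1 ?_) (measurable_iff_comap_le.1 ?_)
  · exact measurable_fedAvg hg ηg ηl K θ₀ (fun u hu => hmS _ u hu) fun u hu i k => hmξ _ u i k hu
  · exact measurable_sample_batches (hmS {q | round q = t} t rfl) fun i k =>
      hmξ {q | round q = t} t i k rfl

variable [IsProbabilityMeasure P] {p : Fin M → ℝ} {r : Fin m → Fin M → ℝ}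
  {loss : Fin M → Model d → ℝ} {L σ : ℝ}

omit [IsProbabilityMeasure P] in
theorem IsRunRandomness.isRound (h : IsRunRandomness P (clusteredLaw r) S ξ)
    (hg : ∀ i, Measurable (Function.uncurry (g i))) (hm : 0 < m) (hL : 0 ≤ L)
    (hp : IsImportance p) (hr : IsClusteredSampling p r) (hloss : Smooth loss L)
    (hub : UnbiasedBoundedVariance P loss g ξ σ) (t : ℕ) :
    IsRound P p r g (fun i => gradient (loss i)) (S t) (ξ t) (σ ^ 2) L where
  pos := hm
  importance := hp
  sampling := hr
  oracle i :=
    { measurable_g := hg i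
      measurable_G := measurable_of_lipschitz hL (hloss i).2
      measurable_ζ := h.measurable_ξ t i
      indep := h.indep_ξ.precomp (g := fun k : ℕ => (t, i, k)) fun k k' hk => by simpa using hk
      memLp := fun k x => (hub t i k x).1
      mean := fun k x => (hub t i k x).2.1
      var := fun k x => (hub t i k x).2.2 }
  lipschitz i := (hloss i).2
  indep := h.indep_ξ.precomp (g := fun q : Fin M × ℕ => (t, q)) fun q q' hq => by simpa using hq
  measurable_S := h.measurable_S t
  law_S := h.law_S t
  indep_S := h.indep_S_ξ.comp (φ := fun s : ℕ → Fin m → Fin M => s t)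
    (ψ := fun (b : ℕ × Fin M × ℕ → Ξ) (q : Fin M × ℕ) => b (t, q))
    (measurable_pi_apply t) (measurable_pi_lambda _ fun q => measurable_pi_apply _)

end Run

/-! ### Telescoping over the rounds and the convergence bound. -/

/-- Telescoping written with additions only, so it remains valid for extended values that are not
yet known to be finite. -/
theorem add_sum_le_of_forall_add_le {Φ Γ : ℕ → ENNReal} {R : ENNReal}
    (h : ∀ t, Φ (t + 1) + Γ t ≤ Φ t + R) (T : ℕ) :
    Φ T + ∑ t ∈ Finset.range T, Γ t ≤ Φ 0 + T * R := by
  induction T with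
  | zero => simp
  | succ T ih =>
    calc Φ (T + 1) + ∑ t ∈ Finset.range (T + 1), Γ t
        = (Φ (T + 1) + Γ T) + ∑ t ∈ Finset.range T, Γ t := by
          rw [Finset.sum_range_succ]; ring
      _ ≤ (Φ T + R) + ∑ t ∈ Finset.range T, Γ t := add_le_add_left (h T) _
      _ = (Φ T + ∑ t ∈ Finset.range T, Γ t) + R := by ring
      _ ≤ (Φ 0 + T * R) + R := by gcongr
      _ = _ := by push_cast; ring

/-- Nonnegative random variables `γ t` controlled by the decrease of nonnegative `φ t` are
integrable, and the sum of their expectations is bounded. -/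
theorem integrable_and_sum_integral_le {Ω : Type*} [MeasurableSpace Ω] {P : Measure Ω}
    {φ : ℕ → Ω → ENNReal} {γ : ℕ → Ω → ℝ} (hγ : ∀ t w, 0 ≤ γ t w) (hγm : ∀ t, Measurable (γ t))
    {φ₀ a R : ℝ} (ha : 0 < a) (hR : 0 ≤ R) (hφ₀ : 0 ≤ φ₀)
    (h0 : ∫⁻ w, φ 0 w ∂P ≤ ENNReal.ofReal φ₀)
    (h : ∀ t, ∫⁻ w, φ (t + 1) w ∂P + ENNReal.ofReal a * ∫⁻ w, ENNReal.ofReal (γ t w) ∂P ≤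
      ∫⁻ w, φ t w ∂P + ENNReal.ofReal R) :
    (∀ t, Integrable (γ t) P) ∧
      ∀ T : ℕ, a * ∑ t ∈ Finset.range T, ∫ w, γ t w ∂P ≤ φ₀ + T * R := by
  have hsum : ∀ T : ℕ, ∑ t ∈ Finset.range T,
      ENNReal.ofReal a * ∫⁻ w, ENNReal.ofReal (γ t w) ∂P ≤ ENNReal.ofReal (φ₀ + T * R) := by
    intro T
    refine (le_add_self.trans (add_sum_le_of_forall_add_le h T)).trans ?_
    rw [ENNReal.ofReal_add hφ₀ (by positivity), ENNReal.ofReal_mul (by positivity),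
      ENNReal.ofReal_natCast]
    gcongr
  have hint : ∀ t, Integrable (γ t) P := by
    intro t
    refine ⟨(hγm t).aestronglyMeasurable, ?_⟩
    rw [hasFiniteIntegral_iff_ofReal (Filter.Eventually.of_forall (hγ t))]
    have h1 : ENNReal.ofReal a * ∫⁻ w, ENNReal.ofReal (γ t w) ∂P < ⊤ :=
      ((Finset.single_le_sum (f := fun t => ENNReal.ofReal a *
        ∫⁻ w, ENNReal.ofReal (γ t w) ∂P) (fun _ _ => zero_le) (Finset.self_mem_range_succ t)).trans
        (hsum (t + 1))).trans_lt ENNReal.ofReal_lt_top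
    exact ENNReal.lt_top_of_mul_ne_top_right h1.ne (ENNReal.ofReal_pos.2 ha).ne'
  refine ⟨hint, fun T => ?_⟩
  rw [← ENNReal.ofReal_le_ofReal_iff (by positivity), Finset.mul_sum, ENNReal.ofReal_sum_of_nonneg
    fun t _ => mul_nonneg ha.le (integral_nonneg (hγ t))]
  refine le_trans (le_of_eq (Finset.sum_congr rfl fun t _ => ?_)) (hsum T)
  rw [ENNReal.ofReal_mul ha.le, ofReal_integral_eq_lintegral_ofReal (hint t)
    (Filter.Eventually.of_forall (hγ t))]

theorem fedAvg_convergence {d M m K : ℕ} {p : Fin M → ℝ} {r : Fin m → Fin M → ℝ}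
    {Ω : Type*} [MeasurableSpace Ω] {P : Measure Ω} [IsProbabilityMeasure P]
    {Ξ : Type*} [MeasurableSpace Ξ] {loss : Fin M → Model d → ℝ}
    {g : Fin M → Model d → Ξ → Model d} {S : ℕ → Ω → Fin m → Fin M}
    {ξ : ℕ → Fin M → ℕ → Ω → Ξ} (θ₀ : Model d) {L σ β κ ηg ηl : ℝ}
    (hm : 0 < m) (hK : 0 < K) (hL : 0 ≤ L) (hβ : 1 ≤ β) (hηg : 0 < ηg) (hηl : 0 < ηl)
    (hp : IsImportance p) (hr : IsClusteredSampling p r) (hloss : Smooth loss L)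
    (hdis : BoundedDissimilarity p loss β κ) (hbdd : BddBelow (Set.range (globalLoss p loss)))
    (hg : ∀ i, Measurable (Function.uncurry (g i)))
    (hub : UnbiasedBoundedVariance P loss g ξ σ)
    (hrun : IsRunRandomness P (clusteredLaw r) S ξ)
    (hc : ηl * ((1 + ηg) * β ^ 2 * L * K) ≤ 1 / 32) :
    (∀ t, Integrable (gradSq p loss g ηg ηl K θ₀ S ξ t) P) ∧
      ∀ T : ℕ, ηg * ηl * K / 8 *
          ∑ t ∈ Finset.range T, ∫ w, gradSq p loss g ηg ηl K θ₀ S ξ t w ∂P ≤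
        globalLoss p loss θ₀ - (⨅ x, globalLoss p loss x) +
          T * (ηg * ηl * K * (4 * (L * (ηg * ηl) * (termA (clusteredLaw r) p / m) * σ ^ 2 +
            L ^ 2 * ηl ^ 2 * (K - 1) * σ ^ 2 + L ^ 2 * ηl ^ 2 * (K * (K - 1)) * κ ^ 2 +
            L * (ηg * ηl) * (K / m) * κ ^ 2))) := by
  set f := globalLoss p loss with hf
  set θ : ℕ → Ω → Model d := fun t w =>
    fedAvg g ηg ηl K θ₀ (fun t => S t w) (fun t i k => ξ t i k w) t with hθ
  set R := ηg * ηl * K * (4 * (L * (ηg * ηl) * (termA (clusteredLaw r) p / m) * σ ^ 2 +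
    L ^ 2 * ηl ^ 2 * (K - 1) * σ ^ 2 + L ^ 2 * ηl ^ 2 * (K * (K - 1)) * κ ^ 2 +
    L * (ηg * ηl) * (K / m) * κ ^ 2)) with hRdef
  have hround := hrun.isRound hg hm hL hp hr hloss hub
  have hfc : Continuous f := by
    refine continuous_iff_continuousAt.2 fun x => ?_
    exact (hloss.hasGradientAt_globalLoss p x).differentiableAt.continuousAt
  have hgrad : gradient f = fun x => ∑ i, p i • gradient (loss i) x :=
    funext (hloss.gradient_globalLoss p)
  have hgm : Measurable (gradient f) := by
    refine measurable_of_lipschitz hL fun x y => ?_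
    rw [hgrad]
    exact hloss.norm_gradient_globalLoss_sub_le hp x y
  have hinf : ∀ x, 0 ≤ f x - ⨅ x, f x := fun x => sub_nonneg.2 (ciInf_le hbdd x)
  have hθm : ∀ t, Measurable (θ t) := fun t =>
    measurable_fedAvg hg ηg ηl K θ₀ (fun u _ => hrun.measurable_S u)
      fun u _ i k => hrun.measurable_ξ u i k
  have hR : 0 ≤ R := by
    have hK1 : (0 : ℝ) ≤ K - 1 := by
      have : (1 : ℝ) ≤ K := by exact_mod_cast hK
      linarith
    have hA : 0 ≤ termA (clusteredLaw r) p := mul_nonneg (Nat.cast_nonneg m)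
      (Finset.sum_nonneg fun i _ => add_nonneg (variance_nonneg _ _) (sq_nonneg _))
    positivity
  -- Subtracting the infimum makes the potential nonnegative, so the one-round descent becomes an
  -- inequality of extended integrals.
  have hstep : ∀ t x, ∫⁻ w, ENNReal.ofReal
        (f (roundStep g ηg ηl K x (S t w) (fun i k => ξ t i k w)) - ⨅ x, f x) ∂P +
        ENNReal.ofReal (ηg * ηl * K / 8) * ENNReal.ofReal (‖gradient f x‖ ^ 2) ≤
      ENNReal.ofReal (f x - ⨅ x, f x) + ENNReal.ofReal R := by
    intro t x
    obtain ⟨hi, hle⟩ := (hround t).expected_descent hfc.measurable (θ := x)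
      (fun y => hloss.abs_globalLoss_sub_le hL hp x y) hK hL hβ hηg hηl (hdis x) hc
    have hi' : Integrable (fun w => f (roundStep g ηg ηl K x (S t w) (fun i k => ξ t i k w)) -
        ⨅ x, f x) P := hi.sub (integrable_const _)
    rw [← ofReal_integral_eq_lintegral_ofReal hi'
      (Filter.Eventually.of_forall fun _ => hinf _), ← ENNReal.ofReal_mul (by positivity),
      ← ENNReal.ofReal_add (integral_nonneg fun _ => hinf _) (by positivity),
      ← ENNReal.ofReal_add (hinf _) hR, integral_sub hi (integrable_const _), hgrad]
    refine ENNReal.ofReal_le_ofReal ?_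
    simp only [integral_const, probReal_univ, one_smul]
    linarith
  refine integrable_and_sum_integral_le
    (φ := fun t w => ENNReal.ofReal (f (θ t w) - ⨅ x, f x)) (fun t w => sq_nonneg _)
    (fun t => ((hgm.comp (hθm t)).norm.pow_const 2)) (by positivity) hR (hinf θ₀) ?_ fun t => ?_
  · simp [hθ, fedAvg]
  · let F : Model d × ((Fin m → Fin M) × (Fin M × ℕ → Ξ)) → ENNReal := fun q =>
      ENNReal.ofReal
        (f (roundStep g ηg ηl K q.1 q.2.1 (fun i k => q.2.2 (i, k))) - ⨅ x, f x)
    have hF : Measurable F := by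
      refine ((hfc.measurable.comp ?_).sub_const _).ennreal_ofReal
      exact measurable_roundStep hg ηg ηl K measurable_fst (measurable_fst.comp measurable_snd)
        fun i k => (measurable_pi_apply (i, k)).comp (measurable_snd.comp measurable_snd)
    -- By definition of `fedAvg`, `F` at the current model and the data of round `t` is the
    -- potential at the next model; independence allows freezing the current model and applying
    -- `hstep`.
    have hsplit := lintegral_indepFun_prodMk (hrun.indepFun_fedAvg hg ηg ηl K θ₀ t) (hθm t)
      (measurable_sample_batches (hrun.measurable_S t) (hrun.measurable_ξ t)) hF
    have hγm : Measurable fun w => ENNReal.ofReal (‖gradient f (θ t w)‖ ^ 2) :=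
      ((hgm.comp (hθm t)).norm.pow_const 2).ennreal_ofReal
    refine (add_le_add_left hsplit.le _).trans ?_
    calc _ = ∫⁻ w, (∫⁻ w', F (θ t w, S t w', fun q => ξ t q.1 q.2 w') ∂P +
          ENNReal.ofReal (ηg * ηl * K / 8) * ENNReal.ofReal (‖gradient f (θ t w)‖ ^ 2)) ∂P := by
          rw [lintegral_add_right _ (hγm.const_mul _), lintegral_const_mul _ hγm]
          rfl
      _ ≤ ∫⁻ w, (ENNReal.ofReal (f (θ t w) - ⨅ x, f x) + ENNReal.ofReal R) ∂P :=
          lintegral_mono fun w => hstep t (θ t w)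
      _ = _ := by
          rw [lintegral_add_right _ measurable_const]
          simp

theorem fedAvg_average_bound {d M m K T : ℕ} {p : Fin M → ℝ} {r : Fin m → Fin M → ℝ}
    {Ω : Type*} [MeasurableSpace Ω] {P : Measure Ω} [IsProbabilityMeasure P]
    {Ξ : Type*} [MeasurableSpace Ξ] {loss : Fin M → Model d → ℝ}
    {g : Fin M → Model d → Ξ → Model d} {S : ℕ → Ω → Fin m → Fin M}
    {ξ : ℕ → Fin M → ℕ → Ω → Ξ} (θ₀ : Model d) {L σ β κ ηg ηl : ℝ}
    (hm : 0 < m) (hK : 0 < K) (hT : 0 < T) (hL : 0 ≤ L) (hβ : 1 ≤ β) (hηg : 0 < ηg)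
    (hηl : 0 < ηl)
    (hp : IsImportance p) (hr : IsClusteredSampling p r) (hloss : Smooth loss L)
    (hdis : BoundedDissimilarity p loss β κ) (hbdd : BddBelow (Set.range (globalLoss p loss)))
    (hg : ∀ i, Measurable (Function.uncurry (g i)))
    (hub : UnbiasedBoundedVariance P loss g ξ σ)
    (hrun : IsRunRandomness P (clusteredLaw r) S ξ)
    (hc : ηl * ((1 + ηg) * β ^ 2 * L * K) ≤ 1 / 32) :
    1 / (T : ℝ) * ∑ t ∈ Finset.range T, ∫ w, gradSq p loss g ηg ηl K θ₀ S ξ t w ∂P ≤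
      32 * ((globalLoss p loss θ₀ - ⨅ x, globalLoss p loss x) / (ηg * ηl * K * T)
        + L * (ηg * ηl) * (termA (clusteredLaw r) p / m) * σ ^ 2
        + L ^ 2 * ηl ^ 2 * termB K * σ ^ 2
        + L ^ 2 * ηl ^ 2 * termC K * κ ^ 2
        + L * (ηg * ηl) * (termE K (mdLaw m p) p (1 / m) * σ ^ 2
            + termF K (mdLaw m p) p (1 / m) * κ ^ 2)) := by
  have hmain := (fedAvg_convergence θ₀ hm hK hL hβ hηg hηl hp hr hloss hdis hbdd hg hub hrun hc).2 T
  obtain ⟨-, -, -, -, hE, hF⟩ := sampling_quantities K hm hp hr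
  rw [hE, hF, termB, termC]
  have hK1 : (1 : ℝ) ≤ K := by exact_mod_cast hK
  have hK1' : (0 : ℝ) ≤ K - 1 := by linarith
  have hT' : (0 : ℝ) < T := by exact_mod_cast hT
  have hΔ : 0 ≤ globalLoss p loss θ₀ - ⨅ x, globalLoss p loss x := sub_nonneg.2 (ciInf_le hbdd θ₀)
  set Δ := globalLoss p loss θ₀ - ⨅ x, globalLoss p loss x
  set Γ := ∑ t ∈ Finset.range T, ∫ w, gradSq p loss g ηg ηl K θ₀ S ξ t w ∂P
  set A := L * (ηg * ηl) * (termA (clusteredLaw r) p / m) * σ ^ 2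
  -- The bound of `fedAvg_convergence` contains no `E σ²` term; being nonnegative, that term is
  -- simply added. The constant 32 is the 8 from dividing by `ηg * ηl * K / 8` times the 4 in front
  -- of the errors.
  have hE0 : 0 ≤ L * (ηg * ηl) * ((K - 1) / m) * σ ^ 2 := by positivity
  have hΔ' : 0 ≤ Δ / (ηg * ηl * K * T) := by positivity
  have hpos : 0 < ηg * ηl * K * T / 8 := by positivity
  refine le_of_mul_le_mul_left ?_ hpos
  have e1 : ηg * ηl * K * T / 8 * (1 / (T : ℝ) * Γ) = ηg * ηl * K / 8 * Γ := by field_simp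
  have e2 : ηg * ηl * K * T * (Δ / (ηg * ηl * K * T)) = Δ := by field_simp
  have h3 : 0 ≤ ηg * ηl * K * T * (L * (ηg * ηl) * ((K - 1) / m) * σ ^ 2) := by positivity
  rw [e1]
  refine hmain.trans ?_
  nlinarith

end FedSampling

end

/-! ### Assembly, with `c = 1/32` and `C = 32`. -/

theorem mainTheorem4 :
    -- there are clustered sampling schemes without the covariance structure
    (∃ (M m : ℕ) (p : Fin M → ℝ) (r : Fin m → Fin M → ℝ),
      0 < m ∧ FedSampling.IsImportance p ∧ FedSampling.IsClusteredSampling p r ∧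
      ¬ ∃ α : ℝ, FedSampling.HasCovStructure (FedSampling.clusteredLaw r) p α) ∧
    -- the quantities `A`, `E`, `F` for clustered sampling, and their comparison with MD sampling
    (∀ (M m K : ℕ) (p : Fin M → ℝ) (r : Fin m → Fin M → ℝ),
      0 < m → 0 < K → FedSampling.IsImportance p → FedSampling.IsClusteredSampling p r →
      (∀ i, FedSampling.weightVar (FedSampling.clusteredLaw r) i ≤
        FedSampling.weightVar (FedSampling.mdLaw m p) i) ∧
      FedSampling.termA (FedSampling.clusteredLaw r) p =
        m * (1 / m - 1 / (m : ℝ) ^ 2 * ∑ i, ∑ k, r k i ^ 2 + ∑ i, p i ^ 2) ∧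
      FedSampling.termA (FedSampling.clusteredLaw r) p ≤
        FedSampling.termA (FedSampling.mdLaw m p) p ∧
      FedSampling.HasCovStructure (FedSampling.mdLaw m p) p (1 / m) ∧
      FedSampling.termE K (FedSampling.mdLaw m p) p (1 / m) = ((K : ℝ) - 1) / m ∧
      FedSampling.termF K (FedSampling.mdLaw m p) p (1 / m) = (K : ℝ) / m) ∧
    -- the convergence bound, with absolute constants `c` and `C`
    (∃ c > (0 : ℝ), ∃ C > (0 : ℝ),
      ∀ (d M m K T : ℕ) (p : Fin M → ℝ) (r : Fin m → Fin M → ℝ)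
        (Ω : Type*) [MeasurableSpace Ω] (P : Measure Ω) [IsProbabilityMeasure P]
        (Ξ : Type*) [MeasurableSpace Ξ]
        (loss : Fin M → FedSampling.Model d → ℝ)
        (g : Fin M → FedSampling.Model d → Ξ → FedSampling.Model d)
        (S : ℕ → Ω → Fin m → Fin M) (ξ : ℕ → Fin M → ℕ → Ω → Ξ)
        (θ₀ : FedSampling.Model d) (L σ β κ ηg ηl : ℝ),
      0 < m → 0 < K → 0 < T → 0 ≤ L → 1 ≤ β → 0 < ηg → 0 < ηl →
      FedSampling.IsImportance p →
      FedSampling.IsClusteredSampling p r →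
      FedSampling.Smooth loss L →
      FedSampling.BoundedDissimilarity p loss β κ →
      BddBelow (Set.range (FedSampling.globalLoss p loss)) →
      (∀ i, Measurable (Function.uncurry (g i))) →
      FedSampling.UnbiasedBoundedVariance P loss g ξ σ →
      FedSampling.IsRunRandomness P (FedSampling.clusteredLaw r) S ξ →
      ηl * ((1 + ηg) * β ^ 2 * L * K) ≤ c →
      (∀ t, Integrable (FedSampling.gradSq p loss g ηg ηl K θ₀ S ξ t) P) ∧
      1 / (T : ℝ) * ∑ t ∈ Finset.range T,
          ∫ w, FedSampling.gradSq p loss g ηg ηl K θ₀ S ξ t w ∂P ≤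
        C * ((FedSampling.globalLoss p loss θ₀ - ⨅ x, FedSampling.globalLoss p loss x) /
              (ηg * ηl * K * T)
          + L * (ηg * ηl) * (FedSampling.termA (FedSampling.clusteredLaw r) p / m) * σ ^ 2
          + L ^ 2 * ηl ^ 2 * FedSampling.termB K * σ ^ 2
          + L ^ 2 * ηl ^ 2 * FedSampling.termC K * κ ^ 2
          + L * (ηg * ηl) * (FedSampling.termE K (FedSampling.mdLaw m p) p (1 / m) * σ ^ 2
              + FedSampling.termF K (FedSampling.mdLaw m p) p (1 / m) * κ ^ 2))) := by
  refine ⟨FedSampling.exists_clusteredSampling_not_hasCovStructure,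
    fun M m K p r hm _ hp hr => FedSampling.sampling_quantities K hm hp hr,
    1 / 32, by norm_num, 32, by norm_num, ?_⟩
  intro d M m K T p r Ω _ P _ Ξ _ loss g S ξ θ₀ L σ β κ ηg ηl hm hK hT hL hβ hηg hηl hp hr hloss
    hdis hbdd hg hub hrun hc
  exact ⟨(FedSampling.fedAvg_convergence θ₀ hm hK hL hβ hηg hηl hp hr hloss hdis hbdd hg hub
      hrun hc).1,
    FedSampling.fedAvg_average_bound θ₀ hm hK hT hL hβ hηg hηl hp hr hloss hdis hbdd hg hub
      hrun hc⟩
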